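/- Let $K$ be a field and let $S=K[X_1,\dots,X_n]$ with the standard grading and irrelevant ideal $S_+=(X_1,\dots,X_n)$. For a graded $S$-module $N$ put $\operatorname{reg} N=\sup\{\,i+j : H^i_{S_+}(N)_j\neq 0\,\}$, where $H^i_{S_+}$ denotes local cohomology (so $\operatorname{reg} 0=-\infty$). Let $I\subset S$ be a homogeneous ideal with $\dim S/I=0$, and let $\mathbf x=x_1,\dots,x_l$ be a system of homogeneous, not necessarily minimal, generators of $I$ with degrees $|x_1|\ge |x_2|\ge\dots\ge |x_l|$ (a generator equal to $0$ may be assigned any degree in $\mathbb{Z}_{\ge 0}$); in particular $l\ge n$. Let $M$ be a finitely generated $\mathbb{Z}$-graded $S$-module, let $H_k(\mathbf x,M)$ be its graded Koszul homology modules (the basis element $e_{i_1}\wedge\dots\wedge e_{i_p}$ of the Koszul complex having degree $|x_{i_1}|+\dots+|x_{i_p}|$), let $t_k(M)=\operatorname{reg}\operatorname{Tor}^S_k(M,K)$ where $K=S/S_+$, and let $\operatorname{codim} M$ be the height of the annihilator of $M$ (that is, $n-\dim M$ if $M\neq 0$, and $\infty$ if $M=0$). Then for every integer $k$ with $0\le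 k\le \operatorname{codim} M$, $$\operatorname{reg} H_k(\mathbf x,M)\;\le\;\sum_{i=1}^{n}|x_i|+t_k(M)-n .$$ -/

import Mathlib

open scoped TensorProduct

noncomputable section

namespace KoszulReg

/-! ### Graded modules over the standard graded polynomial ring -/

/-- The polynomial ring `S = K[X_1, ..., X_n]`. -/
abbrev Poly (K : Type*) [Field K] (n : ℕ) : Type _ := MvPolynomial (Fin n) K

/-- The homogeneous component of degree `e : ℤ` of `S` (zero when `e < 0`). -/
def polyGrading (K : Type*) [Field K] (n : ℕ) : ℤ → AddSubgroup (Poly K n)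
  | Int.ofNat d => (MvPolynomial.homogeneousSubmodule (Fin n) K d).toAddSubgroup
  | Int.negSucc _ => ⊥

section Graded

variable (K : Type*) [Field K] (n : ℕ)

/-- The family `𝓜 = (M_j)` of additive subgroups makes `M` a `ℤ`-graded module over `S`:
`M = ⨁ M_j` and `S_d M_j ⊆ M_{d + j}`. -/
structure IsGradedModule {M : Type*} [AddCommGroup M] [Module (Poly K n) M]
    (𝓜 : ℤ → AddSubgroup M) : Prop where
  isInternal : DirectSum.IsInternal 𝓜
  smul_mem : ∀ (d : ℕ) (j : ℤ) (p : Poly K n) (m : M),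
    p.IsHomogeneous d → m ∈ 𝓜 j → p • m ∈ 𝓜 (d + j)

variable {K n}

/-- The grading of the finite product `∏_i M(-a_i)` of shifted copies of a graded module `M`:
a vector `v` has degree `j` when each `v_i` has degree `j - a_i` in `M`. -/
def shiftedPi {M : Type*} [AddCommGroup M] {ι : Type*} (a : ι → ℤ)
    (𝓜 : ℤ → AddSubgroup M) (j : ℤ) : AddSubgroup (ι → M) :=
  AddSubgroup.pi Set.univ fun i => 𝓜 (j - a i)

/-- The quotient `Z / (B ∩ Z)` of submodules of `C` (it is `Z / B` when `B ≤ Z`). -/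
abbrev Subquot {C : Type*} [AddCommGroup C] [Module (Poly K n) C]
    (Z B : Submodule (Poly K n) C) : Type _ :=
  Z ⧸ B.submoduleOf Z

/-- The grading induced on a subquotient `Z / B` of `C` by a grading of `C`: the component of
degree `j` consists of the classes of the elements of `Z` that have degree `j` in `C`. -/
def subquotGrading {C : Type*} [AddCommGroup C] [Module (Poly K n) C]
    (Z B : Submodule (Poly K n) C) (𝓒 : ℤ → AddSubgroup C) (j : ℤ) :
    AddSubgroup (Subquot Z B) :=
  ((𝓒 j).comap Z.subtype.toAddMonoidHom).map (B.submoduleOf Z).mkQ.toAddMonoidHom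

/-- The codimension of `M`: the height of its annihilator (equal to `n - dim M` for finitely
generated `M ≠ 0`, and to `∞` for `M = 0`). -/
def codim (K : Type*) [Field K] (n : ℕ) (M : Type*) [AddCommGroup M] [Module (Poly K n) M] :
    ℕ∞ :=
  (Module.annihilator (Poly K n) M).height

end Graded

/-! ### Koszul homology -/

section Koszul

variable {K : Type*} [Field K] {n l : ℕ}

/-- The term `K_p(x, M)` of the Koszul complex, i.e. `(⋀^p S^l) ⊗ M`: one copy of `M` for each
basis element `e_s`, where `s` runs over the `p`-element subsets of the index set. -/
abbrev KoszulTerm (l : ℕ) (M : Type*) (p : ℕ) : Type _ :=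
  {s : Finset (Fin l) // s.card = p} → M

variable (x : Fin l → Poly K n) (d : Fin l → ℕ)

/-- The Koszul differential `K_{p+1}(x, M) → K_p(x, M)`,
`e_s ⊗ m ↦ ∑_{i ∈ s} (-1)^{#{j ∈ s : j < i}} e_{s \ {i}} ⊗ x_i m`, written in coordinates. -/
def koszulD (M : Type*) [AddCommGroup M] [Module (Poly K n) M] (p : ℕ) :
    KoszulTerm l M (p + 1) →ₗ[Poly K n] KoszulTerm l M p :=
  LinearMap.pi fun t => ∑ i : {i : Fin l // i ∉ t.1},
    ((-1) ^ (t.1.filter (· < i.1)).card * x i.1 : Poly K n) •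
      LinearMap.proj (⟨insert i.1 t.1, by
        rw [Finset.card_insert_of_notMem i.2, t.2]⟩ : {s : Finset (Fin l) // s.card = p + 1})

/-- The grading of `K_p(x, M)`: `e_s` has degree `∑_{i ∈ s} d_i`, where `d_i = deg x_i`. -/
def koszulTermGrading {M : Type*} [AddCommGroup M] (𝓜 : ℤ → AddSubgroup M) (p : ℕ) :
    ℤ → AddSubgroup (KoszulTerm l M p) :=
  shiftedPi (fun s => ∑ i ∈ s.1, (d i : ℤ)) 𝓜

/-- The cycles in `K_p(x, M)`. -/
def koszulCycles (M : Type*) [AddCommGroup M] [Module (Poly K n) M] :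
    (p : ℕ) → Submodule (Poly K n) (KoszulTerm l M p)
  | 0 => ⊤
  | p + 1 => LinearMap.ker (koszulD x M p)

/-- The boundaries in `K_p(x, M)`. -/
def koszulBoundaries (M : Type*) [AddCommGroup M] [Module (Poly K n) M] (p : ℕ) :
    Submodule (Poly K n) (KoszulTerm l M p) :=
  LinearMap.range (koszulD x M p)

/-- The Koszul homology module `H_p(x, M)`. -/
abbrev KoszulHomology (M : Type*) [AddCommGroup M] [Module (Poly K n) M] (p : ℕ) : Type _ :=
  Subquot (koszulCycles x M p) (koszulBoundaries x M p)

/-- The grading of the Koszul homology module `H_p(x, M)`. -/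
def koszulHomologyGrading {M : Type*} [AddCommGroup M] [Module (Poly K n) M]
    (𝓜 : ℤ → AddSubgroup M) (p : ℕ) : ℤ → AddSubgroup (KoszulHomology x M p) :=
  subquotGrading (koszulCycles x M p) (koszulBoundaries x M p) (koszulTermGrading d 𝓜 p)

end Koszul

/-! ### Local cohomology with respect to the irrelevant ideal, and regularity -/

section LocalCohomology

variable (K : Type*) [Field K] (n : ℕ)

variable {n} in
/-- The monomial `X_s = ∏_{i ∈ s} X_i`. -/
def varProd (s : Finset (Fin n)) : Poly K n := ∏ i ∈ s, MvPolynomial.X i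

variable (N : Type*) [AddCommGroup N] [Module (Poly K n) N]

variable {n} in
/-- The localization `N_{X_s} = N[1 / X_s]`. -/
abbrev LocAt (s : Finset (Fin n)) : Type _ :=
  LocalizedModule (Submonoid.powers (varProd K s)) N

variable {n} in
theorem isUnit_varProd_pow {s t : Finset (Fin n)} (h : s ⊆ t)
    (y : Submonoid.powers (varProd K s)) :
    IsUnit (algebraMap (Poly K n) (Module.End (Poly K n) (LocAt K N t)) y) := by
  obtain ⟨_, r, rfl⟩ := y
  have ht : IsUnit (algebraMap (Poly K n) (Module.End (Poly K n) (LocAt K N t))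
      (varProd K t)) :=
    IsLocalizedModule.map_units
      (LocalizedModule.mkLinearMap (Submonoid.powers (varProd K t)) N)
      ⟨varProd K t, Submonoid.mem_powers _⟩
  obtain ⟨u, hu⟩ : varProd K s ∣ varProd K t := Finset.prod_dvd_prod_of_subset _ _ _ h
  have hm : algebraMap (Poly K n) (Module.End (Poly K n) (LocAt K N t)) (varProd K t) =
      algebraMap (Poly K n) (Module.End (Poly K n) (LocAt K N t)) (varProd K s) *
        algebraMap (Poly K n) (Module.End (Poly K n) (LocAt K N t)) u :=
    (congrArg _ hu).trans (map_mul _ _ _)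
  have hc : Commute (algebraMap (Poly K n) (Module.End (Poly K n) (LocAt K N t)) (varProd K s))
      (algebraMap (Poly K n) (Module.End (Poly K n) (LocAt K N t)) u) :=
    Algebra.commutes _ _
  have hs := (hc.isUnit_mul_iff.mp (hm ▸ ht)).1
  simpa only [map_pow] using hs.pow r

variable {n} in
/-- The canonical map `N_{X_s} → N_{X_t}` for `s ⊆ t`. -/
def locMap {s t : Finset (Fin n)} (h : s ⊆ t) : LocAt K N s →ₗ[Poly K n] LocAt K N t :=
  LocalizedModule.lift (Submonoid.powers (varProd K s))
    (LocalizedModule.mkLinearMap (Submonoid.powers (varProd K t)) N)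
    (isUnit_varProd_pow K N h)

/-- The term `C^p = ∏_{#s = p} N_{X_s}` of the Čech complex of `N` on `X_1, ..., X_n`. -/
abbrev CechTerm (p : ℕ) : Type _ :=
  (s : {s : Finset (Fin n) // s.card = p}) → LocAt K N s.1

/-- The Čech differential `C^p → C^{p+1}`,
`(δ c)_t = ∑_{i ∈ t} (-1)^{#{j ∈ t : j < i}} c_{t \ {i}}`. -/
def cechD (p : ℕ) : CechTerm K n N p →ₗ[Poly K n] CechTerm K n N (p + 1) :=
  LinearMap.pi fun t => ∑ i : {i : Fin n // i ∈ t.1},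
    ((-1) ^ (t.1.filter (· < i.1)).card : Poly K n) •
      (locMap K N (Finset.erase_subset i.1 t.1) ∘ₗ
        LinearMap.proj (⟨t.1.erase i.1, by
          rw [Finset.card_erase_of_mem i.2, t.2, Nat.add_sub_cancel]⟩ :
            {s : Finset (Fin n) // s.card = p}))

variable {N}

variable {n} in
/-- The grading of `N_{X_s}`: `m / X_s^r` has degree `j` when `m` is homogeneous of degree
`j + r * #s`. -/
def locGrading (𝓝 : ℤ → AddSubgroup N) (s : Finset (Fin n)) (j : ℤ) :
    AddSubgroup (LocAt K N s) :=
  AddSubgroup.closure {z | ∃ r : ℕ, ∃ m ∈ 𝓝 (j + r * s.card),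
    z = LocalizedModule.mk m ⟨varProd K s ^ r, pow_mem (Submonoid.mem_powers _) r⟩}

/-- The grading of the Čech complex. -/
def cechTermGrading (𝓝 : ℤ → AddSubgroup N) (p : ℕ) (j : ℤ) : AddSubgroup (CechTerm K n N p) :=
  AddSubgroup.pi Set.univ fun s => locGrading K 𝓝 s.1 j

variable (N) in
/-- The coboundaries in `C^p`. -/
def cechCoboundaries : (p : ℕ) → Submodule (Poly K n) (CechTerm K n N p)
  | 0 => ⊥
  | p + 1 => LinearMap.range (cechD K n N p)

variable (N) in
/-- The local cohomology module `H^p_{S_+}(N)`, as the cohomology of the Čech complex. -/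
abbrev LocalCohomology (p : ℕ) : Type _ :=
  Subquot (LinearMap.ker (cechD K n N p)) (cechCoboundaries K n N p)

/-- The grading of the local cohomology module `H^p_{S_+}(N)`. -/
def localCohomologyGrading (𝓝 : ℤ → AddSubgroup N) (p : ℕ) :
    ℤ → AddSubgroup (LocalCohomology K n N p) :=
  subquotGrading (LinearMap.ker (cechD K n N p)) (cechCoboundaries K n N p)
    (cechTermGrading K n 𝓝 p)

/-- The Castelnuovo-Mumford regularity of a graded module,
`reg N = sup {i + j : H^i_{S_+}(N)_j ≠ 0}`, in the extended reals (so `reg 0 = -∞`). -/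
def reg (𝓝 : ℤ → AddSubgroup N) : EReal :=
  sSup {e | ∃ (i : ℕ) (j : ℤ),
    localCohomologyGrading K n 𝓝 i j ≠ ⊥ ∧ e = (((i : ℤ) + j : ℤ) : ℝ)}

end LocalCohomology

/-! ### Graded free resolutions and `Tor` -/

section Tor

variable (K : Type*) [Field K] (n : ℕ)

/-- A graded free resolution `⋯ → F_1 → F_0 → M → 0` of the graded module `M` by graded free
modules of finite rank `F_i = ⨁_c S(-a_{i,c})`, with differentials of degree zero. -/
structure GradedFreeResolution {M : Type*} [AddCommGroup M] [Module (Poly K n) M]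
    (𝓜 : ℤ → AddSubgroup M) where
  rank : ℕ → ℕ
  shift : ∀ i, Fin (rank i) → ℤ
  d : ∀ i, (Fin (rank (i + 1)) → Poly K n) →ₗ[Poly K n] (Fin (rank i) → Poly K n)
  aug : (Fin (rank 0) → Poly K n) →ₗ[Poly K n] M
  d_mem : ∀ i j v, v ∈ shiftedPi (shift (i + 1)) (polyGrading K n) j →
    d i v ∈ shiftedPi (shift i) (polyGrading K n) j
  aug_mem : ∀ j v, v ∈ shiftedPi (shift 0) (polyGrading K n) j → aug v ∈ 𝓜 j
  exact_d : ∀ i, Function.Exact (d (i + 1)) (d i)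
  exact_aug : Function.Exact (d 0) aug
  aug_surjective : Function.Surjective aug

/-- The residue field `K = S / S_+`, as an `S`-module. -/
abbrev ResidueField : Type _ :=
  Poly K n ⧸ Ideal.span (Set.range (MvPolynomial.X : Fin n → Poly K n))

namespace GradedFreeResolution

variable {K n} {M : Type*} [AddCommGroup M] [Module (Poly K n) M] {𝓜 : ℤ → AddSubgroup M}
  (F : GradedFreeResolution K n 𝓜)

/-- The term `F_i ⊗ K`. -/
abbrev Term (i : ℕ) : Type _ := (Fin (F.rank i) → Poly K n) ⊗[Poly K n] ResidueField K n

/-- The differential `F_{i+1} ⊗ K → F_i ⊗ K`. -/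
def tensorD (i : ℕ) : F.Term (i + 1) →ₗ[Poly K n] F.Term i :=
  LinearMap.rTensor (ResidueField K n) (F.d i)

/-- The grading of `F_i ⊗ K`: since `K` is concentrated in degree `0`, the component of degree `j`
is the set of all `v ⊗ 1` with `v` homogeneous of degree `j`. -/
def termGrading (i : ℕ) (j : ℤ) : AddSubgroup (F.Term i) :=
  (shiftedPi (F.shift i) (polyGrading K n) j).map
    ((TensorProduct.mk (Poly K n) (Fin (F.rank i) → Poly K n) (ResidueField K n)).flip
      1).toAddMonoidHom

/-- The cycles in `F_i ⊗ K`. -/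
def cycles : (i : ℕ) → Submodule (Poly K n) (F.Term i)
  | 0 => ⊤
  | i + 1 => LinearMap.ker (F.tensorD i)

/-- The module `Tor_i^S(M, K) = H_i(F ⊗ K)`. -/
abbrev Tor (i : ℕ) : Type _ := Subquot (F.cycles i) (LinearMap.range (F.tensorD i))

/-- The grading of `Tor_i^S(M, K)`. -/
def torGrading (i : ℕ) : ℤ → AddSubgroup (F.Tor i) :=
  subquotGrading (F.cycles i) (LinearMap.range (F.tensorD i)) (F.termGrading i)

end GradedFreeResolution

/-- `t_i(M) = reg Tor_i^S(M, K)`. The graded module `Tor_i^S(M, K)` is computed from a graded free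
resolution `F` of `M`; up to graded isomorphism it does not depend on `F`, so that all the terms of
this supremum agree. -/
def t {M : Type*} [AddCommGroup M] [Module (Poly K n) M] (𝓜 : ℤ → AddSubgroup M) (i : ℕ) :
    EReal :=
  ⨆ F : GradedFreeResolution K n 𝓜, reg K n (F.torGrading i)

end Tor

end KoszulReg

end

/-! Let `F` be a minimal graded free resolution of `M`, and let `T` be the total complex of K(x) ⊗
(F_k → ⋯ → F_0). By minimality every shift of F_k is the degree of a nonzero element of Tor_k(M, K),
hence at most t_k(M) (`shift_le_t`). Since I contains a power of every variable and kills H_k(x, M),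
that module is torsion, and its regularity is bounded by any bound for the degrees of its nonzero
elements (`reg_le_of_torsion`). It remains to show H_k(x, M)_j = 0 for j beyond the bound.

A Koszul cycle lifts by a staircase argument to a cycle of `T` in homological degree k, and a
primitive of the lift projects to a primitive of the given cycle (`exists_lift`, `exists_kosD_eq`).
So H_k(T)_j = 0 is enough. The x_i act on `T` by null-homotopic maps, so `T` becomes exact once a
variable is inverted. Write H^n for the top local cohomology of S. Splitting the passage from S to
H^n into n short exact sequences, each with such an exact middle term, shows that H_k(T) vanishes in
degree j if H_{k+n}(T ⊗ H^n) does (`relExact_poly_of_top`).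

In total degree k + n, row p of T ⊗ H^n is K_{k+n-p}(x) ⊗ F_p ⊗ H^n. If F ⊗ H^n is exact at all
places p < k, each cycle can be moved into row k, that is into K_n(x) ⊗ F_k ⊗ H^n. As H^n lives in
degrees at most -n, this is zero in degree j as soon as j exceeds the sum of the n largest |x_i|
plus the largest shift of F_k minus n (`relExact_top_of_degree`).

Exactness of F ⊗ H^n at p < k expresses the vanishing of local cohomology of M above its dimension.
It is proved directly: since k ≤ codim M, there are n - k homogeneous y_i of positive degree which
together with the annihilator of M generate an ideal containing powers of all variables
(`exists_parameters`). These powers act null-homotopically on K(y) ⊗ F, and the dimension shift run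
upwards makes K(y) ⊗ F ⊗ H^n exact in degrees below n. Each removal of a y_i costs one homological
degree: multiplication by y_i is injective on the homology of the smaller complex, yet each class is
killed by a power of y_i because H^n is bounded above (`relExact_initialIdx`,
`rowExact_of_parameters`).

All coefficient modules are realised as subquotients of the Laurent polynomials spanned by
monomials: H^n is the quotient by the monomials having some nonnegative exponent. Exactness in a
quotient thus becomes exactness up to an error with prescribed exponents (`RelExact`). -/

noncomputable section

namespace KoszulReg

/-! ### The Koszul complex on all subsets at once, and its homotopies -/

section KoszulOperators

variable {R : Type*} [CommRing R] {l : ℕ} {V : Type*} [AddCommGroup V] [Module R V]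

/-- The sign `(-1)^{#{j ∈ s : j < i}}`. -/
def insSign (R : Type*) [CommRing R] {l : ℕ} (s : Finset (Fin l)) (i : Fin l) : R :=
  (-1) ^ (s.filter (· < i)).card

theorem insSign_mul_self (s : Finset (Fin l)) (i : Fin l) :
    insSign R s i * insSign R s i = 1 := by
  rw [insSign, ← mul_pow]; simp

theorem insSign_insert_self (s : Finset (Fin l)) (i : Fin l) :
    insSign R (insert i s) i = insSign R s i := by
  simp [insSign, Finset.filter_insert]

theorem insSign_erase_self (s : Finset (Fin l)) (i : Fin l) :
    insSign R (s.erase i) i = insSign R s i := by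
  rw [insSign, insSign, Finset.filter_erase, Finset.erase_eq_of_notMem (by simp)]

theorem insSign_insert {s : Finset (Fin l)} {i : Fin l} (hi : i ∉ s) (j : Fin l) :
    insSign R (insert i s) j = (if i < j then -1 else 1) * insSign R s j := by
  unfold insSign
  rw [Finset.filter_insert]
  split_ifs with h
  · rw [Finset.card_insert_of_notMem (by simp [hi]), pow_succ, mul_comm]
  · simp

theorem insSign_swap {s : Finset (Fin l)} {i j : Fin l} (hi : i ∉ s) (hj : j ∉ s) (hij : i ≠ j) :
    insSign R s i * insSign R (insert i s) j + insSign R s j * insSign R (insert j s) i = 0 := by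
  rw [insSign_insert hi, insSign_insert hj]
  rcases lt_or_gt_of_ne hij with h | h
  · rw [if_pos h, if_neg h.asymm]; ring
  · rw [if_neg h.asymm, if_pos h]; ring

variable (x : Fin l → R)

/-- The Koszul differential on the whole Koszul complex `⨁_s V e_s`. -/
def kosD (V : Type*) [AddCommGroup V] [Module R V] :
    (Finset (Fin l) → V) →ₗ[R] (Finset (Fin l) → V) :=
  LinearMap.pi fun s => ∑ i, if i ∈ s then 0 else
    (insSign R s i * x i) • LinearMap.proj (insert i s)

/-- Exterior multiplication by `e_i` on the Koszul complex. -/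
def kosWedge (R : Type*) [CommRing R] {l : ℕ} (V : Type*) [AddCommGroup V] [Module R V]
    (i : Fin l) : (Finset (Fin l) → V) →ₗ[R] (Finset (Fin l) → V) :=
  LinearMap.pi fun s => if i ∈ s then insSign R s i • LinearMap.proj (s.erase i) else 0

theorem kosD_apply (z : Finset (Fin l) → V) (s : Finset (Fin l)) :
    kosD x V z s = ∑ i, if i ∈ s then 0 else (insSign R s i * x i) • z (insert i s) := by
  simp only [kosD, LinearMap.pi_apply, LinearMap.sum_apply]
  refine Finset.sum_congr rfl fun i _ => ?_
  split_ifs <;> rfl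

theorem kosWedge_apply (i : Fin l) (z : Finset (Fin l) → V) (s : Finset (Fin l)) :
    kosWedge R V i z s = if i ∈ s then insSign R s i • z (s.erase i) else 0 := by
  simp only [kosWedge, LinearMap.pi_apply]
  split_ifs <;> rfl

theorem kosD_kosD (z : Finset (Fin l) → V) : kosD x V (kosD x V z) = 0 := by
  funext s
  rw [kosD_apply, Pi.zero_apply]
  have : ∀ i, (if i ∈ s then (0 : V) else (insSign R s i * x i) • kosD x V z (insert i s)) =
      ∑ j, if i ∈ s ∨ j ∈ insert i s then 0 else
        (insSign R s i * insSign R (insert i s) j * (x i * x j)) • z (insert j (insert i s)) := by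
    intro i
    split_ifs with h
    · simp [h]
    · rw [kosD_apply, Finset.smul_sum]
      refine Finset.sum_congr rfl fun j _ => ?_
      by_cases hj : j ∈ insert i s
      · simp [hj]
      · rw [if_neg hj, if_neg (by tauto), smul_smul]
        congr 1; ring
  rw [Finset.sum_congr rfl fun i _ => this i, ← Finset.sum_product']
  -- The terms for (i, j) and (j, i) reach the same coordinate with opposite signs, by
  -- `insSign_swap`.
  refine Finset.sum_involution (fun p _ => (p.2, p.1)) ?_ ?_ ?_ ?_
  · rintro ⟨i, j⟩ _
    by_cases h : i ∈ s ∨ j ∈ insert i s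
    · have h' : j ∈ s ∨ i ∈ insert j s := by
        simp only [Finset.mem_insert] at h ⊢; tauto
      simp only [h, h', if_true, add_zero]
    · have h' : ¬ (j ∈ s ∨ i ∈ insert j s) := by
        simp only [Finset.mem_insert] at h ⊢; tauto
      simp only [h, h', if_false]
      simp only [Finset.mem_insert, not_or] at h
      rw [Finset.insert_comm i j, mul_comm (x j), ← add_smul, ← add_mul,
        insSign_swap h.1 h.2.2 (Ne.symm h.2.1), zero_mul, zero_smul]
  · rintro ⟨i, j⟩ _ h
    simp only [ne_eq, Prod.mk.injEq, not_and]
    rintro rfl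
    simp at h
  · intros; exact Finset.mem_univ _
  · intros; rfl

/-- The homotopy formula behind the vanishing of x_i on Koszul homology. In a coordinate s
containing i, the terms with j ≠ i cancel in pairs and the term j = i comes from the second summand
alone; if i is not in s, only the term j = i of the first summand survives. -/
theorem kosD_kosWedge_add (i : Fin l) (z : Finset (Fin l) → V) :
    kosD x V (kosWedge R V i z) + kosWedge R V i (kosD x V z) = x i • z := by
  funext s
  rw [Pi.add_apply, Pi.smul_apply, kosWedge_apply]
  by_cases hi : i ∈ s
  · rw [if_pos hi, kosD_apply, kosD_apply, Finset.smul_sum, ← Finset.sum_add_distrib,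
      Finset.sum_eq_single i]
    · rw [if_pos hi, if_neg (Finset.notMem_erase i s), Finset.insert_erase hi, zero_add, smul_smul,
        insSign_erase_self, ← mul_assoc, insSign_mul_self, one_mul]
    · intro j _ hji
      by_cases hj : j ∈ s
      · rw [if_pos hj, if_pos (Finset.mem_erase.2 ⟨hji, hj⟩), smul_zero, add_zero]
      · rw [if_neg hj, if_neg (fun h => hj (Finset.mem_of_mem_erase h)), kosWedge_apply,
          if_pos (Finset.mem_insert_of_mem hi), Finset.erase_insert_of_ne hji, smul_smul,
          smul_smul, ← add_smul]
        have hj' : j ∉ s.erase i := fun h => hj (Finset.mem_of_mem_erase h)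
        have h1 := insSign_swap (R := R) (Finset.notMem_erase i s) hj' (Ne.symm hji)
        rw [Finset.insert_erase hi, insSign_erase_self] at h1
        have h2 : insSign R (insert j s) i = insSign R (insert j (s.erase i)) i := by
          rw [← Finset.erase_insert_of_ne hji, insSign_erase_self]
        have h3 : insSign R s j * insSign R (insert j s) i +
            insSign R s i * insSign R (s.erase i) j = 0 := by
          have h4 := insSign_insert (R := R) (Finset.notMem_erase i s) j
          have h5 := insSign_insert (R := R) hj i
          rw [Finset.insert_erase hi] at h4
          rw [h4, h5]
          rcases lt_or_gt_of_ne hji with h | h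
          · rw [if_pos h, if_neg h.asymm]; ring
          · rw [if_neg h.asymm, if_pos h]; ring
        have : insSign R s j * x j * insSign R (insert j s) i +
            insSign R s i * (insSign R (s.erase i) j * x j) = 0 := by
          linear_combination x j * h3
        rw [this, zero_smul]
    · simp
  · rw [if_neg hi, add_zero, kosD_apply, Finset.sum_eq_single i]
    · rw [if_neg hi, kosWedge_apply, if_pos (Finset.mem_insert_self _ _), smul_smul,
        Finset.erase_insert hi, insSign_insert_self, mul_right_comm, insSign_mul_self, one_mul]
    · intro j _ hji
      by_cases hj : j ∈ s
      · rw [if_pos hj]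
      · rw [if_neg hj, kosWedge_apply, if_neg, smul_zero]
        simp [hi, Ne.symm hji]
    · simp

end KoszulOperators

/-! ### Comparison with the Koszul complex in a fixed homological degree -/

section KoszulExtend

variable {K : Type*} [Field K] {n l : ℕ} {M : Type*} [AddCommGroup M] [Module (Poly K n) M]

/-- Extension by zero of a chain of homological degree `p` to the whole Koszul complex. -/
def kosExtend {p : ℕ} (z : KoszulTerm l M p) (s : Finset (Fin l)) : M :=
  if h : s.card = p then z ⟨s, h⟩ else 0

/-- The part of homological degree `p` of an element of the whole Koszul complex. -/
def kosRestrict (p : ℕ) (z : Finset (Fin l) → M) : KoszulTerm l M p := fun s => z s.1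

theorem kosExtend_apply {p : ℕ} (z : KoszulTerm l M p) (s : {s : Finset (Fin l) // s.card = p}) :
    kosExtend z s.1 = z s := by
  simp [kosExtend, s.2]

theorem koszulD_kosRestrict (x : Fin l → Poly K n) (p : ℕ) (z : Finset (Fin l) → M) :
    koszulD x M p (kosRestrict (p + 1) z) = kosRestrict p (kosD x M z) := by
  funext s
  simp only [koszulD, LinearMap.pi_apply, LinearMap.sum_apply, LinearMap.smul_apply,
    LinearMap.proj_apply, kosRestrict, kosD_apply]
  rw [Finset.sum_ite, Finset.sum_const_zero, zero_add]
  symm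
  refine Finset.sum_subtype (p := fun i => i ∉ s.1) _ ?_
    (fun i => (insSign (Poly K n) s.1 i * x i) • z (insert i s.1))
  simp

theorem kosRestrict_kosExtend {p : ℕ} (z : KoszulTerm l M p) :
    kosRestrict p (kosExtend z) = z := by
  funext s; exact kosExtend_apply z s

theorem kosD_kosExtend_of_mem_cycles (x : Fin l → Poly K n) {p : ℕ} {z : KoszulTerm l M p}
    (hz : z ∈ koszulCycles x M p) : kosD x M (kosExtend z) = 0 := by
  funext s
  rw [Pi.zero_apply]
  by_cases h : s.card + 1 = p
  · subst h
    have h1 := koszulD_kosRestrict x s.card (kosExtend z)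
    rw [kosRestrict_kosExtend, (show koszulD x M s.card z = 0 from hz)] at h1
    exact (congrFun h1 ⟨s, rfl⟩).symm
  · rw [kosD_apply]
    refine Finset.sum_eq_zero fun i _ => ?_
    split_ifs with hi
    · rfl
    · rw [kosExtend, dif_neg, smul_zero]
      rwa [Finset.card_insert_of_notMem hi]

theorem mem_koszulBoundaries_of_eq (x : Fin l → Poly K n) {p : ℕ} {z : KoszulTerm l M p}
    (b : Finset (Fin l) → M) (h : kosRestrict p (kosD x M b) = z) :
    z ∈ koszulBoundaries x M p :=
  ⟨kosRestrict (p + 1) b, by rw [koszulD_kosRestrict, h]⟩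

/-- For a generator x_i, exterior multiplication by e_i carries the cycle to a primitive of its
x_i-multiple; general elements follow by linearity. -/
theorem smul_mem_koszulBoundaries (x : Fin l → Poly K n) {p : ℕ} {z : KoszulTerm l M p}
    (hz : z ∈ koszulCycles x M p) {a : Poly K n} (ha : a ∈ Ideal.span (Set.range x)) :
    a • z ∈ koszulBoundaries x M p := by
  induction ha using Submodule.span_induction with
  | mem a h =>
    obtain ⟨i, rfl⟩ := h
    refine mem_koszulBoundaries_of_eq x (kosWedge (Poly K n) M i (kosExtend z)) ?_
    have := kosD_kosWedge_add x i (kosExtend z)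
    rw [kosD_kosExtend_of_mem_cycles x hz, map_zero, add_zero] at this
    rw [this]
    funext s
    simp [kosRestrict, kosExtend_apply]
  | zero => simp
  | add a b _ _ h1 h2 => rw [add_smul]; exact add_mem h1 h2
  | smul a b _ h => rw [smul_eq_mul, mul_smul]; exact Submodule.smul_mem _ _ h

end KoszulExtend

/-! ### Laurent polynomials and sets of exponents -/

section Laurent

variable {K : Type*} [Field K] {n : ℕ}

/-- The ring of Laurent polynomials in `n` variables. -/
abbrev Laurent (K : Type*) [Field K] (n : ℕ) : Type _ := AddMonoidAlgebra K (Fin n → ℤ)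

/-- Exponents of monomials as exponents of Laurent monomials. -/
def expEmb (n : ℕ) : (Fin n →₀ ℕ) →+ (Fin n → ℤ) where
  toFun β i := (β i : ℤ)
  map_zero' := by funext i; simp
  map_add' := by intro a b; funext i; simp

theorem expEmb_injective : Function.Injective (expEmb n) := by
  intro a b h
  ext i
  have := congrFun h i
  simpa [expEmb] using this

theorem expEmb_nonneg (β : Fin n →₀ ℕ) (i : Fin n) : 0 ≤ expEmb n β i := by
  simp [expEmb]

theorem sum_expEmb (β : Fin n →₀ ℕ) : ∑ i, expEmb n β i = (β.degree : ℤ) := by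
  simp [expEmb, Finsupp.degree_eq_sum]

/-- The inclusion of polynomials into Laurent polynomials. -/
def toLaurent (K : Type*) [Field K] (n : ℕ) : Poly K n →+* Laurent K n :=
  AddMonoidAlgebra.mapDomainRingHom K (expEmb n)

instance laurentAlgebra : Algebra (Poly K n) (Laurent K n) := (toLaurent K n).toAlgebra

theorem smul_laurent_def (p : Poly K n) (f : Laurent K n) : p • f = toLaurent K n p * f := rfl

theorem toLaurent_injective : Function.Injective (toLaurent K n) :=
  AddMonoidAlgebra.mapDomain_injective expEmb_injective

/-- The Laurent polynomials all of whose exponents lie in `A`. -/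
def supportedIn (K : Type*) [Field K] {n : ℕ} (A : Set (Fin n → ℤ)) : AddSubgroup (Laurent K n) :=
  (AddMonoidAlgebra.supported K K A).toAddSubgroup

theorem mem_supportedIn {A : Set (Fin n → ℤ)} {f : Laurent K n} :
    f ∈ supportedIn K A ↔ ∀ α ∈ f.coeff.support, α ∈ A := by
  change f ∈ AddMonoidAlgebra.supported K K A ↔ _
  rw [AddMonoidAlgebra.mem_supported]
  rfl

theorem supportedIn_mono {A B : Set (Fin n → ℤ)} (h : A ⊆ B) :
    supportedIn K A ≤ supportedIn K B := fun _ hf =>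
  mem_supportedIn.2 fun α hα => h (mem_supportedIn.1 hf α hα)

theorem supportedIn_inter {A B : Set (Fin n → ℤ)} {f : Laurent K n} :
    f ∈ supportedIn K (A ∩ B) ↔ f ∈ supportedIn K A ∧ f ∈ supportedIn K B := by
  simp only [mem_supportedIn, Set.mem_inter_iff]
  exact ⟨fun h => ⟨fun α hα => (h α hα).1, fun α hα => (h α hα).2⟩,
    fun h α hα => ⟨h.1 α hα, h.2 α hα⟩⟩

theorem eq_zero_of_supportedIn_empty {f : Laurent K n} (h : f ∈ supportedIn K ∅) : f = 0 := by
  apply AddMonoidAlgebra.coeff_injective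
  rw [AddMonoidAlgebra.coeff_zero, ← Finsupp.support_eq_empty, Finset.eq_empty_iff_forall_notMem]
  exact fun α hα => mem_supportedIn.1 h α hα

theorem mul_mem_supportedIn {A B C : Set (Fin n → ℤ)} {f g : Laurent K n}
    (hf : f ∈ supportedIn K A) (hg : g ∈ supportedIn K B)
    (h : ∀ α ∈ A, ∀ β ∈ B, α + β ∈ C) : f * g ∈ supportedIn K C := by
  classical
  rw [mem_supportedIn] at *
  intro γ hγ
  have := AddMonoidAlgebra.support_coeff_mul_subset f g hγ
  obtain ⟨α, hα, β, hβ, rfl⟩ := Finset.mem_add.1 this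
  exact h α (hf α hα) β (hg β hβ)

theorem mem_support_toLaurent {p : Poly K n} {γ : Fin n → ℤ}
    (h : γ ∈ (toLaurent K n p).coeff.support) : ∃ β ∈ p.support, expEmb n β = γ := by
  classical
  have h1 : (toLaurent K n p).coeff = Finsupp.mapDomain (expEmb n) (AddMonoidAlgebra.coeff p) := rfl
  rw [h1] at h
  obtain ⟨β, hβ, h2⟩ := Finset.mem_image.1 (Finsupp.mapDomain_support h)
  exact ⟨β, hβ, h2⟩

theorem smul_mem_supportedIn {A B : Set (Fin n → ℤ)} {p : Poly K n} {f : Laurent K n}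
    (hf : f ∈ supportedIn K A) (h : ∀ α ∈ A, ∀ β ∈ p.support, expEmb n β + α ∈ B) :
    p • f ∈ supportedIn K B := by
  rw [smul_laurent_def]
  refine mul_mem_supportedIn (A := {γ | ∃ β ∈ p.support, expEmb n β = γ}) ?_ hf ?_
  · rw [mem_supportedIn]; exact fun γ hγ => mem_support_toLaurent hγ
  · rintro _ ⟨β, hβ, rfl⟩ α hα
    exact h α hα β hβ

theorem exists_toLaurent_eq {f : Laurent K n} (hf : f ∈ supportedIn K {α | ∀ i, 0 ≤ α i}) :
    ∃ p : Poly K n, toLaurent K n p = f ∧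
      ∀ β ∈ p.support, expEmb n β ∈ f.coeff.support := by
  classical
  rw [mem_supportedIn] at hf
  refine ⟨AddMonoidAlgebra.ofCoeff (f.coeff.comapDomain (expEmb n) expEmb_injective.injOn),
    ?_, ?_⟩
  · apply AddMonoidAlgebra.coeff_injective
    change Finsupp.mapDomain (expEmb n) (f.coeff.comapDomain (expEmb n) _) = _
    refine Finsupp.mapDomain_comapDomain _ expEmb_injective _ ?_
    intro α hα
    have := hf α hα
    refine ⟨Finsupp.equivFunOnFinite.symm fun i => (α i).toNat, ?_⟩
    funext i
    simpa [expEmb] using this i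
  · intro β hβ
    have : β ∈ (f.coeff.comapDomain (expEmb n) expEmb_injective.injOn).support := hβ
    simpa using this

open Classical in
/-- Restriction of a Laurent polynomial to the exponents in `A`. -/
def restrictTo (A : Set (Fin n → ℤ)) : Laurent K n →+ Laurent K n where
  toFun f := AddMonoidAlgebra.ofCoeff (f.coeff.filter (· ∈ A))
  map_zero' := by
    apply AddMonoidAlgebra.coeff_injective; exact Finsupp.filter_zero _
  map_add' f g := by
    apply AddMonoidAlgebra.coeff_injective; exact Finsupp.filter_add

theorem mem_support_restrictTo {A : Set (Fin n → ℤ)} {f : Laurent K n} {α : Fin n → ℤ} :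
    α ∈ (restrictTo A f).coeff.support ↔ α ∈ f.coeff.support ∧ α ∈ A := by
  classical
  change α ∈ (f.coeff.filter (· ∈ A)).support ↔ _
  rw [Finsupp.support_filter, Finset.mem_filter]

theorem restrictTo_mem {A B : Set (Fin n → ℤ)} {f : Laurent K n} (hf : f ∈ supportedIn K B) :
    restrictTo A f ∈ supportedIn K (B ∩ A) := by
  rw [mem_supportedIn] at *
  exact fun α hα => ⟨hf α (mem_support_restrictTo.1 hα).1, (mem_support_restrictTo.1 hα).2⟩

theorem sub_restrictTo_mem {A B : Set (Fin n → ℤ)} {f : Laurent K n} (hf : f ∈ supportedIn K B) :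
    f - restrictTo A f ∈ supportedIn K (B \ A) := by
  classical
  rw [mem_supportedIn] at *
  have h : f - restrictTo A f = AddMonoidAlgebra.ofCoeff (f.coeff.filter (fun α => ¬ α ∈ A)) := by
    rw [sub_eq_iff_eq_add']
    apply AddMonoidAlgebra.coeff_injective
    exact (Finsupp.filter_add_filter_not f.coeff (· ∈ A)).symm
  rw [h]
  intro α hα
  change α ∈ (f.coeff.filter (fun α => ¬ α ∈ A)).support at hα
  rw [Finsupp.support_filter, Finset.mem_filter] at hα
  exact ⟨hf α hα.1, hα.2⟩

theorem restrictTo_eq_self {A : Set (Fin n → ℤ)} {f : Laurent K n} (hf : f ∈ supportedIn K A) :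
    restrictTo A f = f := by
  have := sub_restrictTo_mem (A := A) hf
  rw [Set.sdiff_self] at this
  exact (sub_eq_zero.1 (eq_zero_of_supportedIn_empty this)).symm

theorem restrictTo_eq_zero {A : Set (Fin n → ℤ)} {f : Laurent K n} (hf : f ∈ supportedIn K Aᶜ) :
    restrictTo A f = 0 := by
  have := restrictTo_mem (A := A) hf
  rw [Set.compl_inter_self] at this
  exact eq_zero_of_supportedIn_empty this

/-- The Laurent monomial `X_i^e`. -/
def laurentVar (K : Type*) [Field K] {n : ℕ} (i : Fin n) (e : ℤ) : Laurent K n :=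
  AddMonoidAlgebra.single (Pi.single i e) 1

theorem laurentVar_mem (i : Fin n) (e : ℤ) :
    laurentVar K i e ∈ supportedIn K {Pi.single i e} := by
  rw [mem_supportedIn]
  intro α hα
  change α ∈ (Finsupp.single (Pi.single i e) (1 : K)).support at hα
  exact Finset.mem_singleton.1 (Finsupp.support_single_subset hα)

theorem toLaurent_X_pow (i : Fin n) (N : ℕ) :
    toLaurent K n (MvPolynomial.X i ^ N) = laurentVar K i N := by
  rw [MvPolynomial.X_pow_eq_monomial]
  change AddMonoidAlgebra.mapDomain (expEmb n) (AddMonoidAlgebra.single _ 1) = _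
  rw [AddMonoidAlgebra.mapDomain_single, laurentVar]
  congr 1
  funext j
  simp only [expEmb, AddMonoidHom.coe_mk, ZeroHom.coe_mk, Finsupp.single_apply, Pi.single_apply]
  split_ifs <;> simp_all

theorem X_pow_smul_laurentVar_smul (i : Fin n) (N : ℕ) (f : Laurent K n) :
    (MvPolynomial.X i ^ N : Poly K n) • (laurentVar K i (-N) * f) = f := by
  rw [smul_laurent_def, toLaurent_X_pow, ← mul_assoc, laurentVar, laurentVar,
    AddMonoidAlgebra.single_mul_single, ← Pi.single_add]
  simp [← AddMonoidAlgebra.one_def]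

end Laurent

/-! ### The total complex of a Koszul complex and a complex of free modules -/

/-- A complex `⋯ → F_1 → F_0` of graded free modules of finite rank over `S`, given by homogeneous
matrices. -/
structure FreeSeq (K : Type*) [Field K] (n : ℕ) where
  rank : ℕ → ℕ
  shift : ∀ p, Fin (rank p) → ℤ
  mat : ∀ p, Matrix (Fin (rank p)) (Fin (rank (p + 1))) (Poly K n)
  mat_hom : ∀ p a b, ∀ β ∈ (mat p a b).support,
    (β.degree : ℤ) = shift (p + 1) b - shift p a
  mat_mul : ∀ p, mat p * mat (p + 1) = 0

section TotalComplex

variable {K : Type*} [Field K] {n l : ℕ} (F : FreeSeq K n)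

/-- The direct product of the modules `F_p ⊗ A`. -/
abbrev FreeSeq.Coeff (A : Type*) : Type _ := ∀ p, Fin (F.rank p) → A

/-- The differential of `F ⊗ A`. -/
def FreeSeq.diff (A : Type*) [AddCommGroup A] [Module (Poly K n) A] :
    F.Coeff A →ₗ[Poly K n] F.Coeff A :=
  LinearMap.pi fun p => LinearMap.pi fun a => ∑ b,
    F.mat p a b • ((LinearMap.proj (φ := fun _ => A) b).comp
      (LinearMap.proj (φ := fun p => Fin (F.rank p) → A) (p + 1)))

variable {A : Type*} [AddCommGroup A] [Module (Poly K n) A]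

theorem FreeSeq.diff_apply (v : F.Coeff A) (p : ℕ) (a : Fin (F.rank p)) :
    F.diff A v p a = ∑ b, F.mat p a b • v (p + 1) b := by
  simp [FreeSeq.diff]

theorem FreeSeq.diff_diff (v : F.Coeff A) : F.diff A (F.diff A v) = 0 := by
  funext p a
  rw [F.diff_apply]
  simp only [F.diff_apply, Finset.smul_sum, smul_smul, Pi.zero_apply]
  rw [Finset.sum_comm]
  refine Finset.sum_eq_zero fun c _ => ?_
  rw [← Finset.sum_smul]
  have := congrFun (congrFun (F.mat_mul p) a) c
  rw [Matrix.mul_apply] at this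
  rw [this, Matrix.zero_apply, zero_smul]

/-- The module `⨁_s F ⊗ A` underlying the total complex `K(x) ⊗ F ⊗ A`. -/
abbrev FreeSeq.Tot (l : ℕ) (A : Type*) : Type _ := Finset (Fin l) → F.Coeff A

/-- The operator `F`-differential with sign on the total complex. -/
def FreeSeq.rowD (l : ℕ) (A : Type*) [AddCommGroup A] [Module (Poly K n) A] :
    F.Tot l A →ₗ[Poly K n] F.Tot l A :=
  LinearMap.pi fun s => ((-1) ^ s.card : Poly K n) • (F.diff A ∘ₗ LinearMap.proj s)

theorem FreeSeq.rowD_apply (z : F.Tot l A) (s : Finset (Fin l)) :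
    F.rowD l A z s = ((-1) ^ s.card : Poly K n) • F.diff A (z s) := rfl

/-- The differential of the total complex `K(x) ⊗ F ⊗ A`. -/
def FreeSeq.totD (x : Fin l → Poly K n) (A : Type*) [AddCommGroup A] [Module (Poly K n) A] :
    F.Tot l A →ₗ[Poly K n] F.Tot l A :=
  kosD x (F.Coeff A) + F.rowD l A

variable (x : Fin l → Poly K n)

theorem FreeSeq.totD_apply (z : F.Tot l A) (s : Finset (Fin l)) :
    F.totD x A z s = kosD x (F.Coeff A) z s + ((-1) ^ s.card : Poly K n) • F.diff A (z s) := rfl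

/-- The two differentials anticommute because the Koszul differential changes the cardinality of s
by one, and with it the sign carried by the row differential. -/
theorem FreeSeq.kosD_rowD (z : F.Tot l A) :
    kosD x (F.Coeff A) (F.rowD l A z) + F.rowD l A (kosD x (F.Coeff A) z) = 0 := by
  funext s
  rw [Pi.add_apply, kosD_apply, F.rowD_apply, kosD_apply, map_sum, Finset.smul_sum,
    ← Finset.sum_add_distrib, Pi.zero_apply]
  refine Finset.sum_eq_zero fun i _ => ?_
  split_ifs with hi
  · simp
  · rw [F.rowD_apply, Finset.card_insert_of_notMem hi, map_smul, smul_smul, smul_smul, ← add_smul]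
    ring_nf
    rw [zero_smul]

theorem FreeSeq.totD_totD (z : F.Tot l A) : F.totD x A (F.totD x A z) = 0 := by
  have h1 : F.rowD l A (F.rowD l A z) = 0 := by
    funext s
    rw [F.rowD_apply, F.rowD_apply, map_smul, F.diff_diff, smul_zero, smul_zero, Pi.zero_apply]
  simp only [FreeSeq.totD, LinearMap.add_apply, map_add, kosD_kosD, h1, zero_add, add_zero]
  rw [add_comm]
  exact F.kosD_rowD x z

/-- Exterior multiplication by `e_i` is a homotopy from multiplication by `x_i` to zero. -/
theorem FreeSeq.totD_kosWedge (i : Fin l) (z : F.Tot l A) :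
    F.totD x A (kosWedge (Poly K n) _ i z) + kosWedge (Poly K n) _ i (F.totD x A z) = x i • z := by
  have h : F.rowD l A (kosWedge (Poly K n) _ i z) +
      kosWedge (Poly K n) _ i (F.rowD l A z) = 0 := by
    funext s
    rw [Pi.add_apply, F.rowD_apply, kosWedge_apply, kosWedge_apply, Pi.zero_apply]
    split_ifs with hi
    · rw [F.rowD_apply, map_smul, smul_smul, smul_smul, ← add_smul]
      have : s.card = (s.erase i).card + 1 := (Finset.card_erase_add_one hi).symm
      rw [this, pow_succ]
      ring_nf
      rw [zero_smul]
    · simp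
  simp only [FreeSeq.totD, LinearMap.add_apply, map_add]
  rw [← kosD_kosWedge_add x i z, add_add_add_comm, h, add_zero]

end TotalComplex

/-! ### Supports, internal degrees and homogeneous parts in the total complex -/

section Supports

variable {K : Type*} [Field K] {n l : ℕ} (F : FreeSeq K n)

/-- The elements of the total complex with Laurent coefficients whose coordinates have their
exponents in prescribed sets. -/
def FreeSeq.totSupp (𝒜 : Finset (Fin l) → ∀ p, Fin (F.rank p) → Set (Fin n → ℤ)) :
    AddSubgroup (F.Tot l (Laurent K n)) where
  carrier := {z | ∀ s p c, z s p c ∈ supportedIn K (𝒜 s p c)}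
  zero_mem' _ _ _ := zero_mem _
  add_mem' ha hb s p c := add_mem (ha s p c) (hb s p c)
  neg_mem' ha s p c := neg_mem (ha s p c)

variable {F}

theorem sign_smul_mem_supportedIn {A : Set (Fin n → ℤ)} {f : Laurent K n}
    (hf : f ∈ supportedIn K A) (m : ℕ) : ((-1) ^ m : Poly K n) • f ∈ supportedIn K A := by
  rcases neg_one_pow_eq_or (Poly K n) m with h | h
  · rwa [h, one_smul]
  · rw [h, neg_smul, one_smul]; exact neg_mem hf

theorem FreeSeq.totD_mem {x : Fin l → Poly K n}
    {𝒜 ℬ : Finset (Fin l) → ∀ p, Fin (F.rank p) → Set (Fin n → ℤ)}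
    (h1 : ∀ s p c, ∀ i ∉ s, ∀ α ∈ 𝒜 (insert i s) p c, ∀ β ∈ (x i).support,
      expEmb n β + α ∈ ℬ s p c)
    (h2 : ∀ s p a b, ∀ α ∈ 𝒜 s (p + 1) b, ∀ β ∈ (F.mat p a b).support,
      expEmb n β + α ∈ ℬ s p a)
    {z : F.Tot l (Laurent K n)} (hz : z ∈ F.totSupp 𝒜) :
    F.totD x _ z ∈ F.totSupp ℬ := by
  intro s p c
  rw [F.totD_apply, Pi.add_apply, Pi.add_apply]
  refine add_mem ?_ ?_
  · rw [kosD_apply, Finset.sum_apply, Finset.sum_apply]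
    refine sum_mem fun i _ => ?_
    split_ifs with hi
    · exact zero_mem _
    · rw [mul_smul]
      exact sign_smul_mem_supportedIn (smul_mem_supportedIn (hz _ p c) (h1 s p c i hi)) _
  · rw [Pi.smul_apply, Pi.smul_apply, F.diff_apply]
    refine sign_smul_mem_supportedIn (sum_mem fun b _ => ?_) _
    exact smul_mem_supportedIn (hz s _ b) (h2 s p c b)

variable (F) in
/-- The elements of homological degree `m`, supported on the index set `Ω`, whose internal degrees
lie in `J`. -/
def FreeSeq.gr (d : Fin l → ℕ) (Ω : Set (Finset (Fin l) × ℕ)) (J : Set ℤ) (m : ℤ) :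
    AddSubgroup (F.Tot l (Laurent K n)) :=
  F.totSupp fun s p c => {α | (s, p) ∈ Ω ∧ (s.card : ℤ) + p = m ∧
    ∑ i, α i + (∑ i ∈ s, (d i : ℤ) + F.shift p c) ∈ J}

variable (F) in
/-- The elements whose coordinates all have exponents in `U`. -/
def FreeSeq.inSet (l : ℕ) (U : Set (Fin n → ℤ)) : AddSubgroup (F.Tot l (Laurent K n)) :=
  F.totSupp fun _ _ _ => U

/-- Sets of exponents that are stable under multiplication by monomials. -/
def UpClosed (U : Set (Fin n → ℤ)) : Prop :=
  ∀ α ∈ U, ∀ β, (∀ i, 0 ≤ β i) → β + α ∈ U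

/-- Index sets that are stable under the differential of the total complex. -/
def LowerIdx (Ω : Set (Finset (Fin l) × ℕ)) : Prop :=
  (∀ s p i, i ∉ s → (insert i s, p) ∈ Ω → (s, p) ∈ Ω) ∧ ∀ s p, (s, p + 1) ∈ Ω → (s, p) ∈ Ω

theorem FreeSeq.totD_mem_inSet {x : Fin l → Poly K n} {U : Set (Fin n → ℤ)} (hU : UpClosed U)
    {z : F.Tot l (Laurent K n)} (hz : z ∈ F.inSet l U) : F.totD x _ z ∈ F.inSet l U :=
  FreeSeq.totD_mem (fun _ _ _ _ _ α hα β _ => hU α hα _ (expEmb_nonneg β))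
    (fun _ _ _ _ α hα β _ => hU α hα _ (expEmb_nonneg β)) hz

theorem FreeSeq.totD_mem_gr {x : Fin l → Poly K n} {d : Fin l → ℕ}
    (hx : ∀ i, (x i).IsHomogeneous (d i)) {Ω : Set (Finset (Fin l) × ℕ)} (hΩ : LowerIdx Ω)
    {J : Set ℤ} {m : ℤ} {z : F.Tot l (Laurent K n)} (hz : z ∈ F.gr d Ω J (m + 1)) :
    F.totD x _ z ∈ F.gr d Ω J m := by
  refine FreeSeq.totD_mem ?_ ?_ hz
  · rintro s p c i hi α ⟨h1, h2, h3⟩ β hβ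
    refine ⟨hΩ.1 s p i hi h1, ?_, ?_⟩
    · rw [Finset.card_insert_of_notMem hi] at h2
      push_cast at h2; omega
    · have h4 : (β.degree : ℤ) = d i := by
        have := hx i (MvPolynomial.mem_support_iff.1 hβ)
        rw [Finsupp.degree_eq_weight_one]
        exact_mod_cast this
      rw [Finset.sum_insert hi] at h3
      convert h3 using 1
      simp only [Pi.add_apply, Finset.sum_add_distrib, sum_expEmb, h4]
      ring
  · rintro s p a b α ⟨h1, h2, h3⟩ β hβ
    refine ⟨hΩ.2 s p h1, ?_, ?_⟩
    · push_cast at h2; omega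
    · convert h3 using 1
      simp only [Pi.add_apply, Finset.sum_add_distrib, sum_expEmb, F.mat_hom p a b β hβ]
      ring

/-- Coordinatewise restriction of exponents. -/
def FreeSeq.cut (𝒜 : Finset (Fin l) → ∀ p, Fin (F.rank p) → Set (Fin n → ℤ)) :
    F.Tot l (Laurent K n) →+ F.Tot l (Laurent K n) where
  toFun z s p c := restrictTo (𝒜 s p c) (z s p c)
  map_zero' := by funext s p c; exact map_zero _
  map_add' a b := by funext s p c; exact map_add _ _ _

theorem FreeSeq.cut_mem {𝒜 ℬ 𝒞 : Finset (Fin l) → ∀ p, Fin (F.rank p) → Set (Fin n → ℤ)}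
    (h : ∀ s p c, ℬ s p c ∩ 𝒜 s p c ⊆ 𝒞 s p c)
    {z : F.Tot l (Laurent K n)} (hz : z ∈ F.totSupp ℬ) : FreeSeq.cut 𝒜 z ∈ F.totSupp 𝒞 :=
  fun s p c => supportedIn_mono (h s p c) (restrictTo_mem (hz s p c))

theorem FreeSeq.sub_cut_mem {𝒜 ℬ 𝒞 : Finset (Fin l) → ∀ p, Fin (F.rank p) → Set (Fin n → ℤ)}
    (h : ∀ s p c, ℬ s p c \ 𝒜 s p c ⊆ 𝒞 s p c)
    {z : F.Tot l (Laurent K n)} (hz : z ∈ F.totSupp ℬ) : z - FreeSeq.cut 𝒜 z ∈ F.totSupp 𝒞 :=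
  fun s p c => supportedIn_mono (h s p c) (sub_restrictTo_mem (hz s p c))

/-- The component of internal degree `j`. -/
def FreeSeq.homPart (d : Fin l → ℕ) (j : ℤ) :
    F.Tot l (Laurent K n) →+ F.Tot l (Laurent K n) :=
  FreeSeq.cut fun s p c => {α | ∑ i, α i + (∑ i ∈ s, (d i : ℤ) + F.shift p c) = j}

theorem FreeSeq.homPart_mem_gr {d : Fin l → ℕ} {Ω : Set (Finset (Fin l) × ℕ)} {J : Set ℤ}
    {m j : ℤ} {z : F.Tot l (Laurent K n)} (hz : z ∈ F.gr d Ω J m) :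
    FreeSeq.homPart d j z ∈ F.gr d Ω {j} m :=
  by
  refine FreeSeq.cut_mem ?_ hz
  exact fun _ _ _ _ h => ⟨h.1.1, h.1.2.1, h.2⟩

theorem FreeSeq.cut_mem_inSet {𝒜 : Finset (Fin l) → ∀ p, Fin (F.rank p) → Set (Fin n → ℤ)}
    {U : Set (Fin n → ℤ)} {z : F.Tot l (Laurent K n)} (hz : z ∈ F.inSet l U) :
    FreeSeq.cut 𝒜 z ∈ F.inSet l U :=
  FreeSeq.cut_mem (fun _ _ _ _ h => h.1) hz

theorem FreeSeq.homPart_eq_self {d : Fin l → ℕ} {Ω : Set (Finset (Fin l) × ℕ)}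
    {m j : ℤ} {z : F.Tot l (Laurent K n)} (hz : z ∈ F.gr d Ω {j} m) :
    FreeSeq.homPart d j z = z := by
  funext s p c
  exact restrictTo_eq_self (supportedIn_mono (fun _ h => h.2.2) (hz s p c))

theorem FreeSeq.homPart_totD {x : Fin l → Poly K n} {d : Fin l → ℕ}
    (hx : ∀ i, (x i).IsHomogeneous (d i)) (j : ℤ) {z : F.Tot l (Laurent K n)}
    {Ω : Set (Finset (Fin l) × ℕ)} (hΩ : LowerIdx Ω)
    {m : ℤ} (hz : z ∈ F.gr d Ω Set.univ (m + 1)) :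
    FreeSeq.homPart d j (F.totD x _ z) = F.totD x _ (FreeSeq.homPart d j z) := by
  have h1 := FreeSeq.homPart_mem_gr (j := j) hz
  have h2 : z - FreeSeq.homPart d j z ∈ F.gr d Ω {j}ᶜ (m + 1) := by
    refine FreeSeq.sub_cut_mem ?_ hz
    exact fun _ _ _ _ h => ⟨h.1.1, h.1.2.1, h.2⟩
  have h3 : F.totD x _ z = F.totD x _ (FreeSeq.homPart d j z) +
      F.totD x _ (z - FreeSeq.homPart d j z) := by rw [← map_add]; congr 1; abel
  rw [h3, map_add, FreeSeq.homPart_eq_self (FreeSeq.totD_mem_gr hx hΩ h1)]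
  have h4 : FreeSeq.homPart d j (F.totD x _ (z - FreeSeq.homPart d j z)) = 0 := by
    have := FreeSeq.totD_mem_gr hx hΩ h2
    funext s p c
    exact restrictTo_eq_zero (supportedIn_mono (fun _ h => h.2.2) (this s p c))
  rw [h4, add_zero]

end Supports

/-! ### Dimension shifting between S and its top local cohomology -/

section DimensionShift

variable {K : Type*} [Field K] {n l : ℕ} (F : FreeSeq K n) (x : Fin l → Poly K n)

theorem FreeSeq.totD_map {A B : Type*} [AddCommGroup A] [Module (Poly K n) A] [AddCommGroup B]
    [Module (Poly K n) B] (φ : A →ₗ[Poly K n] B) (z : F.Tot l A) :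
    F.totD x B (fun s p c => φ (z s p c)) = fun s p c => φ (F.totD x A z s p c) := by
  funext s p c
  simp only [F.totD_apply, kosD_apply, F.diff_apply, Pi.add_apply, Pi.smul_apply,
    Finset.sum_apply, map_add, map_sum, map_smul]
  congr 1
  refine Finset.sum_congr rfl fun i _ => ?_
  split_ifs <;> simp

/-- The multiples `a` of the identity of the total complex that are homotopic to zero, by a homotopy
respecting supports. -/
def FreeSeq.nullIdeal (Ω : Set (Finset (Fin l) × ℕ)) : Ideal (Poly K n) where
  carrier := {a | ∃ h : F.Tot l (Laurent K n) →+ F.Tot l (Laurent K n),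
    (∀ z, F.totD x _ (h z) + h (F.totD x _ z) = a • z) ∧
    (∀ U : Set (Fin n → ℤ), UpClosed U → ∀ z ∈ F.inSet l U, h z ∈ F.inSet l U) ∧
    -- Only the homological degree and `Ω` are controlled: with J = univ the weights are irrelevant.
    -- Homogeneity of the homotopy is not asked for, as homogeneous parts can be taken afterwards.
    ∀ m, ∀ z ∈ F.gr (fun _ => 0) Ω Set.univ m, h z ∈ F.gr (fun _ => 0) Ω Set.univ (m + 1)}
  zero_mem' := ⟨0, by simp, fun _ _ _ _ => zero_mem _, fun _ _ _ => zero_mem _⟩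
  add_mem' := by
    rintro a b ⟨h, h1, h2, h3⟩ ⟨h', h1', h2', h3'⟩
    refine ⟨h + h', fun z => ?_, fun U hU z hz => add_mem (h2 U hU z hz) (h2' U hU z hz),
      fun m z hz => add_mem (h3 m z hz) (h3' m z hz)⟩
    rw [add_smul, ← h1, ← h1', AddMonoidHom.add_apply, AddMonoidHom.add_apply, map_add]
    abel
  smul_mem' := by
    rintro c a ⟨h, h1, h2, h3⟩
    refine ⟨(DistribSMul.toAddMonoidHom _ c).comp h, fun z => ?_, fun U hU z hz s p q => ?_,
      fun m z hz s p q => ?_⟩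
    · change F.totD x _ (c • h z) + c • h _ = _
      rw [map_smul, ← smul_add, h1, smul_smul, smul_eq_mul]
    · exact smul_mem_supportedIn (h2 U hU z hz s p q)
        fun α hα β _ => hU α hα _ (expEmb_nonneg β)
    · refine smul_mem_supportedIn (h3 m z hz s p q) ?_
      rintro α ⟨h4, h5, -⟩ β -
      exact ⟨h4, h5, trivial⟩

variable {F x}

theorem FreeSeq.mem_gr_univ {d d' : Fin l → ℕ} {Ω : Set (Finset (Fin l) × ℕ)} {J : Set ℤ} {m : ℤ}
    {z : F.Tot l (Laurent K n)} (hz : z ∈ F.gr d Ω J m) : z ∈ F.gr d' Ω Set.univ m := by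
  refine fun s p c => supportedIn_mono ?_ (hz s p c)
  exact fun _ h => ⟨h.1, h.2.1, trivial⟩

/-- The condition on `Ω` keeps e_i ∧ z inside the subcomplex. It holds for truncations in the row
index, which leave s unrestricted. -/
theorem FreeSeq.mem_nullIdeal_of_wedge {Ω : Set (Finset (Fin l) × ℕ)} (i : Fin l)
    (hΩ : ∀ s p, i ∈ s → (s.erase i, p) ∈ Ω → (s, p) ∈ Ω) : x i ∈ F.nullIdeal x Ω := by
  refine ⟨(kosWedge (Poly K n) _ i).toAddMonoidHom, F.totD_kosWedge x i, ?_, ?_⟩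
  · intro U hU z hz s p c
    change kosWedge (Poly K n) _ i z s p c ∈ _
    rw [kosWedge_apply]
    split_ifs
    · exact sign_smul_mem_supportedIn (hz _ p c) _
    · exact zero_mem _
  · intro m z hz s p c
    change kosWedge (Poly K n) _ i z s p c ∈ _
    rw [kosWedge_apply]
    split_ifs with hi
    · refine sign_smul_mem_supportedIn (supportedIn_mono ?_ (hz _ p c)) _
      rintro α ⟨h1, h2, -⟩
      refine ⟨hΩ s p hi h1, ?_, trivial⟩
      rw [← h2, ← Finset.card_erase_add_one hi]
      push_cast; ring
    · exact zero_mem _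

variable (F x) in
/-- Exactness, in homological degree `m` and internal degree `j`, of the part indexed by `Ω` of the
complex `K(x) ⊗ F ⊗ L_U / L_{U ∩ W}`, where `L_U` denotes the span of the Laurent monomials with
exponents in `U`. -/
def FreeSeq.RelExact (d : Fin l → ℕ) (Ω : Set (Finset (Fin l) × ℕ)) (U W : Set (Fin n → ℤ))
    (m j : ℤ) : Prop :=
  ∀ z ∈ F.gr d Ω {j} m, z ∈ F.inSet l U → F.totD x _ z ∈ F.inSet l W →
    ∃ b ∈ F.gr d Ω {j} (m + 1), b ∈ F.inSet l U ∧ z - F.totD x _ b ∈ F.inSet l W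

variable {d : Fin l → ℕ} (hx : ∀ i, (x i).IsHomogeneous (d i)) {Ω : Set (Finset (Fin l) × ℕ)}
  (hΩ : LowerIdx Ω)
include hx hΩ

/-- A power of X_i acts both invertibly on the coefficients and null-homotopically on the complex,
which forces exactness. -/
theorem FreeSeq.relExact_of_invertible {i : Fin n} {N : ℕ}
    (hN : MvPolynomial.X i ^ N ∈ F.nullIdeal x Ω) {U W : Set (Fin n → ℤ)}
    (hU : UpClosed U) (hW : UpClosed W)
    (hU' : ∀ α ∈ U, ∀ e, Pi.single i e + α ∈ U) (hW' : ∀ α ∈ W, ∀ e, Pi.single i e + α ∈ W)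
    (m j : ℤ) : F.RelExact x d Ω U W m j := by
  intro z hz hzU hDz
  obtain ⟨h, h1, h2, h3⟩ := hN
  let φ : Laurent K n →ₗ[Poly K n] Laurent K n :=
    LinearMap.mulLeft (Poly K n) (laurentVar K i (-N))
  have hφ : ∀ {V : Set (Fin n → ℤ)}, (∀ α ∈ V, ∀ e, Pi.single i e + α ∈ V) →
      ∀ {f}, f ∈ supportedIn K V → φ f ∈ supportedIn K V := fun {V} hV {f} hf =>
    mul_mem_supportedIn (laurentVar_mem i (-N)) hf
      fun α hα β hβ => by rw [Set.mem_singleton_iff.1 hα]; exact hV β hβ _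
  -- With z' = X_i^{-N} z the homotopy formula reads D(h z') + h(D z') = z, and D z' still has
  -- exponents in W because W is stable under powers of X_i of either sign.
  set z' : F.Tot l (Laurent K n) := fun s p c => φ (z s p c) with hz'
  have e1 : (MvPolynomial.X i ^ N : Poly K n) • z' = z := by
    funext s p c
    exact X_pow_smul_laurentVar_smul i N _
  have e2 : z' ∈ F.gr (fun _ => 0) Ω Set.univ m := by
    intro s p c
    by_cases hc : (s, p) ∈ Ω ∧ (s.card : ℤ) + p = m
    · rw [mem_supportedIn]
      exact fun α _ => ⟨hc.1, hc.2, trivial⟩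
    · have : z s p c = 0 := eq_zero_of_supportedIn_empty
        (supportedIn_mono (fun α hα => hc ⟨hα.1, hα.2.1⟩) (hz s p c))
      change φ (z s p c) ∈ _
      rw [this, map_zero]; exact zero_mem _
  have e3 : z' ∈ F.inSet l U := fun s p c => hφ hU' (hzU s p c)
  have e4 : F.totD x _ z' ∈ F.inSet l W := by
    rw [hz', F.totD_map x φ]
    exact fun s p c => hφ hW' (hDz s p c)
  have e5 : h z' ∈ F.gr d Ω Set.univ (m + 1) := FreeSeq.mem_gr_univ (h3 m z' e2)
  -- Neither the division by X_i^N nor `h` preserves the internal degree, so the component of degree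
  -- j is extracted here.
  refine ⟨FreeSeq.homPart d j (h z'), FreeSeq.homPart_mem_gr e5,
    FreeSeq.cut_mem_inSet (h2 U hU z' e3), ?_⟩
  rw [← FreeSeq.homPart_totD hx j hΩ e5]
  have e6 : z - FreeSeq.homPart d j (F.totD x _ (h z')) =
      FreeSeq.homPart d j (h (F.totD x _ z')) := by
    have := h1 z'
    rw [e1] at this
    conv_lhs => rw [← FreeSeq.homPart_eq_self hz, ← this]
    rw [map_add, add_sub_cancel_left]
  rw [e6]
  exact FreeSeq.cut_mem_inSet (h2 W hW _ e4)

/-- Dimension shifting downwards along `0 → A → B → C → 0`. -/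
theorem FreeSeq.relExact_of_shift {U V W W' : Set (Fin n → ℤ)} (hV : UpClosed V) (hW : UpClosed W)
    (hUV : U ⊆ V) (hsplit : ∀ α ∈ V, α ∈ W' → α ∈ U ∨ α ∈ W) (hUW' : U ⊆ W') (hWW' : W ⊆ W')
    {m j : ℤ} (hC : F.RelExact x d Ω V W' (m + 1) j) (hB : F.RelExact x d Ω V W m j) :
    F.RelExact x d Ω U W m j := by
  intro z hz hzU hDz
  obtain ⟨b, hb, hbV, hzb⟩ := hB z hz (fun s p c => supportedIn_mono hUV (hzU s p c)) hDz
  have h1 : F.totD x _ b ∈ F.inSet l W' := by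
    rw [← sub_sub_cancel z (F.totD x _ b)]
    exact sub_mem (fun s p c => supportedIn_mono hUW' (hzU s p c))
      (fun s p c => supportedIn_mono hWW' (hzb s p c))
  obtain ⟨v, hv, hvV, hbv⟩ := hC b hb hbV h1
  -- In B the element z bounds b, and b is a cycle in C. Subtracting the boundary D v does not
  -- change D b but brings b into V ∩ W', so that modulo W it comes from A.
  set y := b - F.totD x _ v with hy
  have hyV : y ∈ F.inSet l V := sub_mem hbV (FreeSeq.totD_mem_inSet hV hvV)
  have hyg : y ∈ F.gr d Ω {j} (m + 1) := sub_mem hb (FreeSeq.totD_mem_gr hx hΩ hv)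
  have hyVW : y ∈ F.totSupp fun _ _ _ => V ∩ W' :=
    fun s p c => supportedIn_inter.2 ⟨hyV s p c, hbv s p c⟩
  refine ⟨FreeSeq.cut (fun _ _ _ => U) y, ?_, ?_, ?_⟩
  · refine FreeSeq.cut_mem ?_ hyg
    exact fun _ _ _ _ h => h.1
  · refine FreeSeq.cut_mem ?_ hyV
    exact fun _ _ _ _ h => h.2
  · have h2 : y - FreeSeq.cut (fun _ _ _ => U) y ∈ F.inSet l W := by
      refine FreeSeq.sub_cut_mem ?_ hyVW
      exact fun _ _ _ α h => (hsplit α h.1.1 h.1.2).resolve_left h.2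
    have h3 : z - F.totD x _ (FreeSeq.cut (fun _ _ _ => U) y) =
        (z - F.totD x _ b) + F.totD x _ (y - FreeSeq.cut (fun _ _ _ => U) y) := by
      have h4 : F.totD x _ y = F.totD x _ b := by
        rw [hy, map_sub, F.totD_totD, sub_zero]
      rw [map_sub (F.totD x _) y, h4]; abel
    rw [h3]
    exact add_mem hzb (FreeSeq.totD_mem_inSet hW h2)

/-- Dimension shifting upwards along `0 → A → B → C → 0`. -/
theorem FreeSeq.relExact_shift {U V W W' : Set (Fin n → ℤ)} (hV : UpClosed V) (hW : UpClosed W)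
    (hUV : U ⊆ V) (hsplit : ∀ α ∈ V, α ∈ W' → α ∈ U ∨ α ∈ W) (hUW' : U ⊆ W') (hWW' : W ⊆ W')
    {m j : ℤ} (hA : F.RelExact x d Ω U W m j) (hB : F.RelExact x d Ω V W (m + 1) j) :
    F.RelExact x d Ω V W' (m + 1) j := by
  intro z hz hzV hDz
  -- This is the connecting homomorphism: D z vanishes in C, so modulo W it is represented by its
  -- part with exponents in U, a cycle of A.
  set y := F.totD x _ z with hy
  have hyV : y ∈ F.inSet l V := FreeSeq.totD_mem_inSet hV hzV
  have hyg : y ∈ F.gr d Ω {j} m := FreeSeq.totD_mem_gr hx hΩ hz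
  have hyVW : y ∈ F.totSupp fun _ _ _ => V ∩ W' :=
    fun s p c => supportedIn_inter.2 ⟨hyV s p c, hDz s p c⟩
  set y1 := FreeSeq.cut (fun _ _ _ => U) y with hy1
  have h2 : y - y1 ∈ F.inSet l W := by
    refine FreeSeq.sub_cut_mem ?_ hyVW
    exact fun _ _ _ α h => (hsplit α h.1.1 h.1.2).resolve_left h.2
  have hy1g : y1 ∈ F.gr d Ω {j} m := by
    refine FreeSeq.cut_mem ?_ hyg
    exact fun _ _ _ _ h => h.1
  have hy1U : y1 ∈ F.inSet l U := by
    refine FreeSeq.cut_mem ?_ hyV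
    exact fun _ _ _ _ h => h.2
  have h3 : F.totD x _ y1 ∈ F.inSet l W := by
    have : F.totD x _ y1 = - F.totD x _ (y - y1) := by
      rw [map_sub, hy, F.totD_totD]; abel
    rw [this]
    exact neg_mem (FreeSeq.totD_mem_inSet hW h2)
  obtain ⟨b, hb, hbU, hyb⟩ := hA y1 hy1g hy1U h3
  obtain ⟨v, hv, hvV, hzv⟩ := hB (z - b) (sub_mem hz hb)
    (sub_mem hzV fun s p c => supportedIn_mono hUV (hbU s p c)) (by
      have : F.totD x _ (z - b) = (y - y1) + (y1 - F.totD x _ b) := by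
        rw [map_sub]; abel
      rw [this]; exact add_mem h2 hyb)
  refine ⟨v, hv, hvV, ?_⟩
  have : z - F.totD x _ v = b + (z - b - F.totD x _ v) := by abel
  rw [this]
  exact add_mem (fun s p c => supportedIn_mono hUW' (hbU s p c))
    (fun s p c => supportedIn_mono hWW' (hzv s p c))

omit hx hΩ

/-- The exponents that are nonnegative from the `i`-th position on. -/
def nonnegFrom (n i : ℕ) : Set (Fin n → ℤ) := {α | ∀ r : Fin n, i ≤ r.val → 0 ≤ α r}

/-- The exponents with some nonnegative entry before the `i`-th position. -/
def nonnegSome (n i : ℕ) : Set (Fin n → ℤ) := {α | ∃ r : Fin n, r.val < i ∧ 0 ≤ α r}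

theorem upClosed_nonnegFrom (n i : ℕ) : UpClosed (nonnegFrom n i) :=
  fun _ hα _ hβ r hr => add_nonneg (hβ r) (hα r hr)

theorem upClosed_nonnegSome (n i : ℕ) : UpClosed (nonnegSome n i) := by
  rintro α ⟨r, hr, h⟩ β hβ
  exact ⟨r, hr, add_nonneg (hβ r) h⟩

include hx hΩ

/-- The middle term is the localization at X_i: neither exponent set restricts position i, one
concerning only later positions and the other only earlier ones. -/
theorem FreeSeq.relExact_middle (hN : ∀ i : Fin n, ∃ N, MvPolynomial.X i ^ N ∈ F.nullIdeal x Ω)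
    {i : ℕ} (hi : i < n) (m j : ℤ) :
    F.RelExact x d Ω (nonnegFrom n (i + 1)) (nonnegSome n i) m j := by
  obtain ⟨N, hN⟩ := hN ⟨i, hi⟩
  refine FreeSeq.relExact_of_invertible hx hΩ hN (upClosed_nonnegFrom _ _)
    (upClosed_nonnegSome _ _) ?_ ?_ m j
  · intro α hα e r hr
    have : r ≠ ⟨i, hi⟩ := by rintro rfl; simp at hr
    simpa [Pi.single_eq_of_ne this] using hα r hr
  · rintro α ⟨r, hr, h⟩ e
    have : r ≠ ⟨i, hi⟩ := by rintro rfl; simp at hr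
    exact ⟨r, hr, by simpa [Pi.single_eq_of_ne this] using h⟩

-- With H^i the i-th local cohomology of S along its first i variables, these inclusions encode 0 →
-- H^i → H^i[1/X_i] → H^{i+1} → 0. The endpoints are H^0 = S and the top local cohomology H^n.
omit hx hΩ in
theorem nonneg_split {i : ℕ} (hi : i < n) :
    nonnegFrom n i ⊆ nonnegFrom n (i + 1) ∧
    (∀ α ∈ nonnegFrom n (i + 1), α ∈ nonnegSome n (i + 1) →
      α ∈ nonnegFrom n i ∨ α ∈ nonnegSome n i) ∧
    nonnegFrom n i ⊆ nonnegSome n (i + 1) ∧ nonnegSome n i ⊆ nonnegSome n (i + 1) := by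
  refine ⟨fun α h r hr => h r (by omega), ?_, fun α h => ⟨⟨i, hi⟩, by simp, h _ le_rfl⟩, ?_⟩
  · rintro α h1 ⟨r, hr, h2⟩
    rcases Nat.lt_succ_iff_lt_or_eq.1 hr with h | h
    · exact Or.inr ⟨r, h, h2⟩
    · refine Or.inl fun r' hr' => ?_
      rcases hr'.eq_or_lt with h3 | h3
      · have : r' = r := Fin.ext (by omega)
        rwa [this]
      · exact h1 r' h3
  · rintro α ⟨r, hr, h⟩
    exact ⟨r, by omega, h⟩

/-- Exactness with coefficients in top local cohomology of `S` implies exactness with coefficients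
in `S`. -/
theorem FreeSeq.relExact_poly_of_top
    (hN : ∀ i : Fin n, ∃ N, MvPolynomial.X i ^ N ∈ F.nullIdeal x Ω) {m j : ℤ}
    (h : F.RelExact x d Ω (nonnegFrom n n) (nonnegSome n n) (m + n) j) :
    F.RelExact x d Ω (nonnegFrom n 0) (nonnegSome n 0) m j := by
  have key : ∀ i ≤ n, F.RelExact x d Ω (nonnegFrom n (n - i)) (nonnegSome n (n - i))
      (m + (n - i : ℕ)) j := by
    intro i
    induction i with
    | zero => intro _; simpa using h
    | succ i ih =>
      intro hi
      have ih' := ih (by omega)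
      have e : n - i = n - (i + 1) + 1 := by omega
      rw [e] at ih'
      obtain ⟨h1, h2, h3, h4⟩ := nonneg_split (n := n) (i := n - (i + 1)) (by omega)
      refine FreeSeq.relExact_of_shift hx hΩ (upClosed_nonnegFrom _ _)
        (upClosed_nonnegSome _ _) h1 h2 h3 h4 ?_
        (FreeSeq.relExact_middle hx hΩ hN (by omega) _ _)
      convert ih' using 1
      push_cast; ring
  simpa using key n le_rfl

/-- Homology with coefficients in H^n in degree q is controlled by homology with coefficients in S
in degree q - n, where the complex is zero because q - n is negative. -/
theorem FreeSeq.relExact_top_of_lt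
    (hN : ∀ i : Fin n, ∃ N, MvPolynomial.X i ^ N ∈ F.nullIdeal x Ω) {q j : ℤ} (hq : q < n) :
    F.RelExact x d Ω (nonnegFrom n n) (nonnegSome n n) q j := by
  have key : ∀ i ≤ n, F.RelExact x d Ω (nonnegFrom n i) (nonnegSome n i) (q - n + i) j := by
    intro i
    induction i with
    | zero =>
      intro _ z hz _ _
      have : z = 0 := by
        funext s p c
        refine eq_zero_of_supportedIn_empty (supportedIn_mono ?_ (hz s p c))
        rintro α ⟨-, h, -⟩
        simp only [Nat.cast_zero] at h
        omega
      refine ⟨0, zero_mem _, zero_mem _, ?_⟩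
      rw [this, map_zero, sub_zero]; exact zero_mem _
    | succ i ih =>
      intro hi
      obtain ⟨h1, h2, h3, h4⟩ := nonneg_split (n := n) (i := i) (by omega)
      have := FreeSeq.relExact_shift hx hΩ (upClosed_nonnegFrom _ _)
        (upClosed_nonnegSome _ _) h1 h2 h3 h4 (ih (by omega))
        (FreeSeq.relExact_middle hx hΩ hN (by omega) _ _)
      convert this using 1
      push_cast; ring
  have := key n le_rfl
  simpa using this

end DimensionShift

/-! ### Elements annihilating H_0 act null-homotopically on a resolution -/

section RowHomotopy

variable {K : Type*} [Field K] {n l : ℕ} {F : FreeSeq K n} {x : Fin l → Poly K n}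

/-- The complex `F` is exact in positive degrees. -/
def FreeSeq.Acyclic (F : FreeSeq K n) : Prop :=
  ∀ p v, (F.mat p).mulVec v = 0 → ∃ u, (F.mat (p + 1)).mulVec u = v

theorem exists_matrix_mul_eq {R : Type*} [CommRing R] {a b c : Type*} [Fintype b] [Fintype c]
    [DecidableEq c]
    (P : Matrix a b R) (Q : Matrix a c R) (h : ∀ v, ∃ u, P.mulVec u = Q.mulVec v) :
    ∃ H : Matrix b c R, P * H = Q := by
  choose f hf using fun j : c => h (Pi.single j 1)
  refine ⟨Matrix.of fun i j => f j i, ?_⟩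
  ext i j
  have := congrFun (hf j) i
  rw [Matrix.mulVec_single_one] at this
  simpa [Matrix.mul_apply, Matrix.mulVec, dotProduct] using this

theorem FreeSeq.exists_homotopy (hF : F.Acyclic) {a : Poly K n}
    (ha : ∀ v, ∃ u, (F.mat 0).mulVec u = a • v) :
    ∃ H : ∀ p, Matrix (Fin (F.rank (p + 1))) (Fin (F.rank p)) (Poly K n),
      F.mat 0 * H 0 = a • 1 ∧ ∀ p, F.mat (p + 1) * H (p + 1) + H p * F.mat p = a • 1 := by
  -- The invariant d H d = a d says exactly that a - H d maps into the kernel of d, so acyclicity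
  -- lifts it through the next differential; the new H' satisfies the same invariant because d d =
  -- 0.
  have step : ∀ p (H : {H : Matrix (Fin (F.rank (p + 1))) (Fin (F.rank p)) (Poly K n) //
      F.mat p * H * F.mat p = a • F.mat p}),
      ∃ H' : {H' : Matrix (Fin (F.rank (p + 1 + 1))) (Fin (F.rank (p + 1))) (Poly K n) //
        F.mat (p + 1) * H' * F.mat (p + 1) = a • F.mat (p + 1)},
        F.mat (p + 1) * H'.1 + H.1 * F.mat p = a • 1 := by
    rintro p ⟨H, hH⟩
    obtain ⟨H', hH'⟩ := exists_matrix_mul_eq (F.mat (p + 1)) (a • 1 - H * F.mat p) (by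
      intro v
      apply hF
      rw [Matrix.mulVec_mulVec, Matrix.mul_sub, ← Matrix.mul_assoc, hH, Matrix.mul_smul,
        Matrix.mul_one, sub_self, Matrix.zero_mulVec])
    refine ⟨⟨H', ?_⟩, by rw [hH', sub_add_cancel]⟩
    rw [hH', Matrix.sub_mul, Matrix.mul_assoc, F.mat_mul, Matrix.mul_zero, sub_zero,
      Matrix.smul_mul, Matrix.one_mul]
  obtain ⟨H0, hH0⟩ := exists_matrix_mul_eq (F.mat 0) (a • 1) (by
    intro v
    obtain ⟨u, hu⟩ := ha v
    exact ⟨u, by rw [hu, Matrix.smul_mulVec, Matrix.one_mulVec]⟩)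
  choose f hf using step
  let g : ∀ p, {H : Matrix (Fin (F.rank (p + 1))) (Fin (F.rank p)) (Poly K n) //
      F.mat p * H * F.mat p = a • F.mat p} := fun p =>
    Nat.rec ⟨H0, by rw [hH0, Matrix.smul_mul, Matrix.one_mul]⟩ (fun p H => f p H) p
  exact ⟨fun p => (g p).1, hH0, fun p => hf p (g p)⟩

/-- The operator on `F ⊗ A` of degree one given by a family of matrices. -/
def FreeSeq.raise (H : ∀ p, Matrix (Fin (F.rank (p + 1))) (Fin (F.rank p)) (Poly K n))
    (A : Type*) [AddCommGroup A] [Module (Poly K n) A] : F.Coeff A →ₗ[Poly K n] F.Coeff A where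
  toFun v
    | 0 => 0
    | p + 1 => fun c => ∑ b, H p c b • v p b
  map_add' u v := by
    funext p c
    cases p with
    | zero => exact (add_zero _).symm
    | succ p => simp [Finset.sum_add_distrib]
  map_smul' r v := by
    funext p c
    cases p with
    | zero =>
      change (0 : A) = r • (0 : A)
      rw [smul_zero]
    | succ p =>
      simp only [Pi.smul_apply, RingHom.id_apply, Finset.smul_sum]
      exact Finset.sum_congr rfl fun b _ => smul_comm _ _ _

theorem FreeSeq.diff_raise_add {a : Poly K n}
    {H : ∀ p, Matrix (Fin (F.rank (p + 1))) (Fin (F.rank p)) (Poly K n)}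
    (h0 : F.mat 0 * H 0 = a • 1) (h1 : ∀ p, F.mat (p + 1) * H (p + 1) + H p * F.mat p = a • 1)
    {A : Type*} [AddCommGroup A] [Module (Poly K n) A] (v : F.Coeff A) :
    F.diff A (FreeSeq.raise H A v) + FreeSeq.raise H A (F.diff A v) = a • v := by
  have e1 : ∀ p c, F.diff A (FreeSeq.raise H A v) p c = ∑ b, (F.mat p * H p) c b • v p b := by
    intro p c
    rw [F.diff_apply]
    change ∑ b, F.mat p c b • ∑ b', H p b b' • v p b' = _
    simp only [Finset.smul_sum, smul_smul, Matrix.mul_apply, Finset.sum_smul]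
    exact Finset.sum_comm
  funext p c
  rw [Pi.add_apply, Pi.add_apply, e1]
  have e3 : ∑ b, (a • (1 : Matrix (Fin (F.rank p)) (Fin (F.rank p)) (Poly K n))) c b • v p b =
      (a • v) p c := by
    simp [Matrix.smul_apply, Matrix.one_apply]
  cases p with
  | zero =>
    rw [h0, e3]
    exact add_zero _
  | succ p =>
    have e2 : FreeSeq.raise H A (F.diff A v) (p + 1) c =
        ∑ b, (H p * F.mat p) c b • v (p + 1) b := by
      change ∑ b, H p c b • F.diff A v p b = _
      simp only [F.diff_apply, Finset.smul_sum, smul_smul, Matrix.mul_apply, Finset.sum_smul]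
      exact Finset.sum_comm
    rw [e2, ← Finset.sum_add_distrib, ← e3, ← h1 p]
    refine Finset.sum_congr rfl fun b _ => ?_
    rw [Matrix.add_apply, add_smul]

/-- The sign (-1)^{|s|} makes the row homotopy anticommute with the Koszul differential, which thus
drops out of the formula. Since the homotopy raises the row index it does not respect truncations of
`F`, hence the full index set. -/
theorem FreeSeq.mem_nullIdeal_of_homotopy {a : Poly K n}
    {H : ∀ p, Matrix (Fin (F.rank (p + 1))) (Fin (F.rank p)) (Poly K n)}
    (h0 : F.mat 0 * H 0 = a • 1) (h1 : ∀ p, F.mat (p + 1) * H (p + 1) + H p * F.mat p = a • 1) :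
    a ∈ F.nullIdeal x Set.univ := by
  let h : F.Tot l (Laurent K n) →ₗ[Poly K n] F.Tot l (Laurent K n) :=
    LinearMap.pi fun s => ((-1) ^ s.card : Poly K n) • (FreeSeq.raise H _ ∘ₗ LinearMap.proj s)
  have hh : ∀ z s, h z s = ((-1) ^ s.card : Poly K n) • FreeSeq.raise H _ (z s) := fun _ _ => rfl
  refine ⟨h.toAddMonoidHom, fun z => ?_, ?_, ?_⟩
  · funext s
    change F.totD x _ (h z) s + h (F.totD x _ z) s = a • z s
    rw [F.totD_apply, hh, hh, F.totD_apply, ← F.diff_raise_add h0 h1, map_add, map_smul, map_smul,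
      smul_add, smul_smul, smul_smul, ← mul_pow, neg_one_mul, neg_neg, one_pow, one_smul, one_smul]
    have : kosD x _ (h z) s +
        ((-1) ^ s.card : Poly K n) • FreeSeq.raise H _ (kosD x _ z s) = 0 := by
      rw [kosD_apply, kosD_apply, map_sum, Finset.smul_sum, ← Finset.sum_add_distrib]
      refine Finset.sum_eq_zero fun i _ => ?_
      split_ifs with hi
      · simp
      · rw [hh, Finset.card_insert_of_notMem hi, map_smul, smul_smul, smul_smul, ← add_smul]
        ring_nf
        rw [zero_smul]
    rw [add_add_add_comm, this, zero_add]
  · intro U hU z hz s p c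
    change h z s p c ∈ _
    rw [hh, Pi.smul_apply, Pi.smul_apply]
    refine sign_smul_mem_supportedIn ?_ _
    cases p with
    | zero => exact zero_mem _
    | succ p =>
      change ∑ b, H p c b • z s p b ∈ _
      exact sum_mem fun b _ => smul_mem_supportedIn (hz s p b)
        fun α hα β _ => hU α hα _ (expEmb_nonneg β)
  · intro m z hz s p c
    change h z s p c ∈ _
    rw [hh, Pi.smul_apply, Pi.smul_apply]
    refine sign_smul_mem_supportedIn ?_ _
    cases p with
    | zero => exact zero_mem _
    | succ p =>
      change ∑ b, H p c b • z s p b ∈ _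
      refine sum_mem fun b _ => smul_mem_supportedIn (hz s p b) ?_
      rintro α ⟨-, h5, -⟩ β -
      refine ⟨trivial, ?_, trivial⟩
      push_cast; omega

end RowHomotopy

/-! ### Removing Koszul generators when coefficients are bounded above -/

section RemoveGenerators

variable {K : Type*} [Field K] {n l : ℕ} {F : FreeSeq K n} {y : Fin l → Poly K n}

theorem kosD_add {R V : Type*} [CommRing R] [AddCommGroup V] [Module R V] (x x' : Fin l → R)
    (z : Finset (Fin l) → V) : kosD (x + x') V z = kosD x V z + kosD x' V z := by
  funext s
  rw [Pi.add_apply, kosD_apply, kosD_apply, kosD_apply, ← Finset.sum_add_distrib]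
  refine Finset.sum_congr rfl fun i _ => ?_
  split_ifs
  · simp
  · rw [Pi.add_apply, mul_add, add_smul]

/-- Polarization of D² = 0, as the Koszul differential is additive in the sequence x. -/
theorem kosD_anticomm {R V : Type*} [CommRing R] [AddCommGroup V] [Module R V] (x x' : Fin l → R)
    (z : Finset (Fin l) → V) : kosD x V (kosD x' V z) + kosD x' V (kosD x V z) = 0 := by
  have := kosD_kosD (x + x') z
  rw [kosD_add, kosD_add, map_add, map_add, kosD_kosD, kosD_kosD, zero_add, add_zero] at this
  rwa [add_comm] at this ⊢

/-- Contraction with the dual basis element of `e_i` anticommutes with the total differential. -/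
theorem FreeSeq.contract_totD (i : Fin l) {A : Type*} [AddCommGroup A] [Module (Poly K n) A]
    (z : F.Tot l A) :
    kosD (Pi.single i 1 : Fin l → Poly K n) _ (F.totD y A z) =
      - F.totD y A (kosD (Pi.single i 1 : Fin l → Poly K n) _ z) := by
  rw [eq_neg_iff_add_eq_zero]
  simp only [FreeSeq.totD, LinearMap.add_apply, map_add]
  rw [add_add_add_comm, kosD_anticomm, F.kosD_rowD, add_zero]

/-- The index set of the part of the total complex using only the first `r` Koszul generators. -/
def initialIdx (l r : ℕ) : Set (Finset (Fin l) × ℕ) := {a | ∀ i ∈ a.1, i.val < r}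

theorem lowerIdx_initialIdx (l r : ℕ) : LowerIdx (initialIdx l r) :=
  ⟨fun _ _ _ _ h j hj => h j (Finset.mem_insert_of_mem hj), fun _ _ h => h⟩

theorem kosD_single_apply {R V : Type*} [CommRing R] [AddCommGroup V] [Module R V] (i : Fin l)
    (z : Finset (Fin l) → V) (s : Finset (Fin l)) :
    kosD (Pi.single i 1 : Fin l → R) V z s =
      if i ∈ s then 0 else insSign R s i • z (insert i s) := by
  rw [kosD_apply, Finset.sum_eq_single i]
  · simp
  · intro j _ hj
    simp [Pi.single_eq_of_ne hj]
  · simp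

theorem insSign_smul_mem {A : Set (Fin n → ℤ)} {f : Laurent K n} (s : Finset (Fin l)) (i : Fin l)
    (hf : f ∈ supportedIn K A) : insSign (Poly K n) s i • f ∈ supportedIn K A :=
  sign_smul_mem_supportedIn hf _

theorem FreeSeq.eq_zero_of_notMem {d : Fin l → ℕ} {Ω : Set (Finset (Fin l) × ℕ)} {J : Set ℤ}
    {m : ℤ} {z : F.Tot l (Laurent K n)} (hz : z ∈ F.gr d Ω J m) {s : Finset (Fin l)} {p : ℕ}
    (h : ¬ ((s, p) ∈ Ω ∧ (s.card : ℤ) + p = m)) : z s p = 0 := by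
  funext c
  exact eq_zero_of_supportedIn_empty (supportedIn_mono (fun _ hα => h ⟨hα.1, hα.2.1⟩) (hz s p c))

variable {d : Fin l → ℕ}

/-- The multiplication by the last Koszul generator is injective on homology as soon as the
larger complex is exact. -/
theorem FreeSeq.exists_of_smul_boundary {W : Set (Fin n → ℤ)} {r : ℕ}
    (hr : r < l) {q j : ℤ}
    (hex : F.RelExact y d (initialIdx l (r + 1)) Set.univ W (q + 1) (j + d ⟨r, hr⟩))
    {z v : F.Tot l (Laurent K n)} (hz : z ∈ F.gr d (initialIdx l r) {j} q)
    (hDz : F.totD y _ z ∈ F.inSet l W)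
    (hv : v ∈ F.gr d (initialIdx l r) {j + d ⟨r, hr⟩} (q + 1))
    (hvz : y ⟨r, hr⟩ • z - F.totD y _ v ∈ F.inSet l W) :
    ∃ b ∈ F.gr d (initialIdx l r) {j} (q + 1), z - F.totD y _ b ∈ F.inSet l W := by
  set i : Fin l := ⟨r, hr⟩ with hi
  have hcontract : ∀ {J : Set ℤ} {m : ℤ} {z : F.Tot l (Laurent K n)},
      z ∈ F.gr d (initialIdx l r) J m → kosD (Pi.single i 1 : Fin l → Poly K n) _ z = 0 := by
    intro J m z hz
    funext s
    rw [kosD_single_apply, Pi.zero_apply]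
    split_ifs
    · rfl
    · have : z (insert i s) = 0 := by
        funext p
        refine FreeSeq.eq_zero_of_notMem hz fun h => ?_
        have h' := h.1 i (Finset.mem_insert_self _ _)
        simp [hi] at h'
      rw [this, smul_zero]
  set w := kosWedge (Poly K n) _ i z with hw
  have hwg : w ∈ F.gr d (initialIdx l (r + 1)) {j + d i} (q + 1) := by
    intro s p c
    rw [hw, kosWedge_apply]
    split_ifs with his
    · refine insSign_smul_mem s i (supportedIn_mono ?_ (hz _ p c))
      rintro α ⟨h1, h2, h3⟩
      refine ⟨fun k hk => ?_, ?_, ?_⟩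
      · by_cases hki : k = i
        · rw [hki]; simp [hi]
        · exact (h1 k (Finset.mem_erase.2 ⟨hki, hk⟩)).trans (Nat.lt_succ_self r)
      · rw [← Finset.card_erase_add_one his]; push_cast; omega
      · rw [Set.mem_singleton_iff] at h3 ⊢
        rw [← Finset.add_sum_erase s _ his, ← h3]; ring
    · exact zero_mem _
  have hvg : v ∈ F.gr d (initialIdx l (r + 1)) {j + d i} (q + 1) := by
    refine fun s p c => supportedIn_mono ?_ (hv s p c)
    rintro α ⟨h1, h2⟩
    exact ⟨fun k hk => (h1 k hk).trans (Nat.lt_succ_self r), h2⟩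
  have hwedge : ∀ {z : F.Tot l (Laurent K n)}, z ∈ F.inSet l W →
      kosWedge (Poly K n) _ i z ∈ F.inSet l W := by
    intro z hz s p c
    rw [kosWedge_apply]
    split_ifs
    · exact insSign_smul_mem s i (hz _ p c)
    · exact zero_mem _
  -- The larger complex is the mapping cone of y_r, and e_r ∧ z - v is a cycle in it modulo W: D(e_r
  -- ∧ z) equals y_r z up to e_r ∧ D z.
  obtain ⟨b, hb, -, hwb⟩ := hex (w - v) (sub_mem hwg hvg)
    (fun s p c => mem_supportedIn.2 fun _ _ => trivial) (by
      have h1 := F.totD_kosWedge y i z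
      have h2 : F.totD y _ (w - v) = (y i • z - F.totD y _ v) -
          kosWedge (Poly K n) _ i (F.totD y _ z) := by
        rw [map_sub, ← h1, hw]; abel
      rw [h2]
      exact sub_mem hvz (hwedge hDz))
  -- Contraction with the dual of e_r sends e_r ∧ z to z and kills v. It anticommutes with D, whence
  -- the sign.
  refine ⟨- kosD (Pi.single i 1 : Fin l → Poly K n) _ b, neg_mem ?_, ?_⟩
  · intro s p c
    rw [kosD_single_apply]
    split_ifs with his
    · exact zero_mem _
    · refine insSign_smul_mem s i (supportedIn_mono ?_ (hb _ p c))
      rintro α ⟨h1, h2, h3⟩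
      refine ⟨fun k hk => ?_, ?_, ?_⟩
      · have h4 := h1 k (Finset.mem_insert_of_mem hk)
        have h5 : k ≠ i := by rintro rfl; exact his hk
        have h6 : k.val ≠ r := fun h => h5 (Fin.ext h)
        change k.val < r
        omega
      · rw [Finset.card_insert_of_notMem his] at h2; push_cast at h2; omega
      · rw [Set.mem_singleton_iff, Finset.sum_insert his] at h3
        rw [Set.mem_singleton_iff]
        linarith
  · have h1 : z - F.totD y _ (- kosD (Pi.single i 1 : Fin l → Poly K n) _ b) =
        kosD (Pi.single i 1 : Fin l → Poly K n) _ (w - v - F.totD y _ b) := by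
      have h2 := kosD_kosWedge_add (Pi.single i 1 : Fin l → Poly K n) i z
      rw [hcontract hz, map_zero, add_zero, Pi.single_eq_same, one_smul] at h2
      rw [map_sub (kosD (Pi.single i 1 : Fin l → Poly K n) _) (w - v),
        map_sub (kosD (Pi.single i 1 : Fin l → Poly K n) _) w, hcontract hv, FreeSeq.contract_totD, hw, h2,
        map_neg]
      abel
    rw [h1]
    intro s p c
    rw [kosD_single_apply]
    split_ifs
    · exact zero_mem _
    · exact insSign_smul_mem s i (hwb _ p c)

theorem exists_shift_bound (F : FreeSeq K n) (d : Fin l → ℕ) (q : ℤ) :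
    ∃ B : ℤ, ∀ s : Finset (Fin l), ∀ p : ℕ, (p : ℤ) ≤ q → ∀ c,
      ∑ i ∈ s, (d i : ℤ) + F.shift p c ≤ B := by
  refine ⟨∑ s : Finset (Fin l), ∑ p ∈ Finset.range (q.toNat + 1), ∑ c,
    |∑ i ∈ s, (d i : ℤ) + F.shift p c|, fun s p hp c => (le_abs_self _).trans ?_⟩
  refine le_trans ?_ (Finset.single_le_sum (f := fun s => ∑ p ∈ Finset.range (q.toNat + 1), ∑ c,
    |∑ i ∈ s, (d i : ℤ) + F.shift p c|) (fun _ _ => by positivity) (Finset.mem_univ s))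
  refine le_trans ?_ (Finset.single_le_sum (f := fun p => ∑ c,
    |∑ i ∈ s, (d i : ℤ) + F.shift p c|) (fun _ _ => by positivity)
    (show p ∈ Finset.range (q.toNat + 1) from Finset.mem_range.2 (by omega)))
  exact Finset.single_le_sum (f := fun c => |∑ i ∈ s, (d i : ℤ) + F.shift p c|)
    (fun _ _ => by positivity) (Finset.mem_univ c)

/-- Top local cohomology of S vanishes in degrees above -n, since n negative exponents sum to at
most -n. -/
theorem mem_nonnegSome_of_lt_sum {α : Fin n → ℤ} (h : -(n : ℤ) < ∑ i, α i) :
    α ∈ nonnegSome n n := by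
  by_contra hα
  have h1 : ∀ i ∈ Finset.univ, α i ≤ -1 := by
    intro i _
    by_contra h2
    exact hα ⟨i, i.2, by omega⟩
  have : ∑ i, α i ≤ _ := Finset.sum_le_card_nsmul _ _ _ h1
  simp at this
  omega

/-- Some power of y_r moves the class of z into degrees where the coefficients vanish, so that power
kills it. Injectivity of multiplication by y_r (`exists_of_smul_boundary`) then removes the factors
one at a time. -/
theorem FreeSeq.relExact_initialIdx (hy : ∀ i, (y i).IsHomogeneous (d i)) (hd : ∀ i, 0 < d i) {r : ℕ} (hr : r < l) {q : ℤ}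
    (hex : ∀ j, F.RelExact y d (initialIdx l (r + 1)) Set.univ (nonnegSome n n) (q + 1) j) (j : ℤ) :
    F.RelExact y d (initialIdx l r) Set.univ (nonnegSome n n) q j := by
  intro z hz _ hDz
  obtain ⟨B, hB⟩ := exists_shift_bound F d q
  set i : Fin l := ⟨r, hr⟩ with hi
  have hpow : ∀ N : ℕ, y i ^ N • z ∈ F.gr d (initialIdx l r) {j + N * d i} q := by
    intro N s p c
    refine smul_mem_supportedIn (hz s p c) ?_
    rintro α ⟨h1, h2, h3⟩ β hβ
    refine ⟨h1, h2, ?_⟩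
    have h4 : (β.degree : ℤ) = N * d i := by
      have := ((hy i).pow N) (MvPolynomial.mem_support_iff.1 hβ)
      rw [Finsupp.degree_eq_weight_one]
      rw [mul_comm]
      exact_mod_cast this
    rw [Set.mem_singleton_iff] at h3 ⊢
    simp only [Pi.add_apply, Finset.sum_add_distrib, sum_expEmb, h4]
    linarith
  have hDpow : ∀ N : ℕ, F.totD y _ (y i ^ N • z) ∈ F.inSet l (nonnegSome n n) := by
    intro N s p c
    rw [map_smul]
    exact smul_mem_supportedIn (hDz s p c)
      fun α hα β _ => upClosed_nonnegSome n n α hα _ (expEmb_nonneg β)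
  obtain ⟨N, hN⟩ : ∃ N : ℕ, y i ^ N • z ∈ F.inSet l (nonnegSome n n) := by
    -- As y_r has degree at least 1, this N makes every exponent sum at least j + N - B ≥ 1, which
    -- exceeds -n.
    refine ⟨(B - j).toNat + 1, fun s p c => ?_⟩
    by_cases hp : (p : ℤ) ≤ q
    · refine supportedIn_mono ?_ (hpow _ s p c)
      rintro α ⟨-, -, h3⟩
      rw [Set.mem_singleton_iff] at h3
      refine mem_nonnegSome_of_lt_sum ?_
      have h4 := hB s p hp c
      have h5 : (((B - j).toNat + 1 : ℕ) : ℤ) ≤ ((B - j).toNat + 1 : ℕ) * (d i : ℤ) :=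
        le_mul_of_one_le_right (by positivity) (by exact_mod_cast hd i)
      have h6 := Int.self_le_toNat (B - j)
      push_cast at h3 h5
      linarith [Int.natCast_nonneg n]
    · have : z s p = 0 := FreeSeq.eq_zero_of_notMem hz fun h => by omega
      simp only [Pi.smul_apply, this, Pi.zero_apply, smul_zero]
      exact zero_mem _
  have key : ∀ k ≤ N, ∃ b ∈ F.gr d (initialIdx l r) {j + (N - k : ℕ) * d i} (q + 1),
      y i ^ (N - k) • z - F.totD y _ b ∈ F.inSet l (nonnegSome n n) := by
    intro k
    induction k with
    | zero => exact fun _ => ⟨0, zero_mem _, by rw [map_zero, sub_zero]; exact hN⟩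
    | succ k ih =>
      intro hk
      obtain ⟨v, hv, hvz⟩ := ih (by omega)
      have e : N - k = N - (k + 1) + 1 := by omega
      refine FreeSeq.exists_of_smul_boundary hr (hex _) (hpow _)
        (hDpow _) (v := v) ?_ ?_
      · rw [e] at hv
        convert hv using 2
        push_cast; rw [hi]; ring_nf
      · rw [smul_smul, ← pow_succ', ← e]
        exact hvz
  obtain ⟨b, hb, hzb⟩ := key N le_rfl
  refine ⟨b, by simpa using hb, fun s p c => mem_supportedIn.2 fun _ _ => trivial,
    by simpa using hzb⟩

end RemoveGenerators

/-! ### Exactness of the rows and the vanishing degree -/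

section DegreeBound

variable {K : Type*} [Field K] {n l : ℕ} (F : FreeSeq K n)

/-- Exactness of `F ⊗ H^n_{S_+}(S)` at the place `p` and in internal degree `j`. -/
def FreeSeq.RowExact (p : ℕ) (j : ℤ) : Prop :=
  ∀ v : F.Coeff (Laurent K n),
    (∀ c, v p c ∈ supportedIn K {α | ∑ i, α i + F.shift p c = j}) →
    (∀ p' c, p' + 1 = p → F.diff _ v p' c ∈ supportedIn K (nonnegSome n n)) →
    ∃ u : Fin (F.rank (p + 1)) → Laurent K n,
      (∀ c, u c ∈ supportedIn K {α | ∑ i, α i + F.shift (p + 1) c = j}) ∧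
      ∀ c, v p c - ∑ b, F.mat p c b • u b ∈ supportedIn K (nonnegSome n n)

variable {F}

theorem nonnegFrom_self (n : ℕ) : nonnegFrom n n = Set.univ :=
  Set.eq_univ_of_forall fun _ r hr => absurd r.2 (by omega)

theorem FreeSeq.diff_single (p : ℕ) (w : Fin (F.rank p) → Laurent K n) {p' : ℕ} (h : p' + 1 ≠ p)
    (c) : F.diff _ (Pi.single p w : F.Coeff (Laurent K n)) p' c = 0 := by
  rw [F.diff_apply]
  refine Finset.sum_eq_zero fun b _ => ?_
  rw [Pi.single_eq_of_ne h, Pi.zero_apply, smul_zero]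

/-- If `l` homogeneous elements of positive degree generate, together with the elements
annihilating `H_0(F)`, an ideal containing powers of all the variables, then the complex
`F ⊗ H^n_{S_+}(S)` is exact at the places `p < n - l`. -/
theorem FreeSeq.rowExact_of_parameters (hF : F.Acyclic) {J : Ideal (Poly K n)}
    (hJ : ∀ a ∈ J, ∀ v, ∃ u, (F.mat 0).mulVec u = a • v) {y : Fin l → Poly K n} {d : Fin l → ℕ}
    (hy : ∀ i, (y i).IsHomogeneous (d i)) (hd : ∀ i, 0 < d i)
    (hm : ∀ i : Fin n, ∃ N, MvPolynomial.X i ^ N ∈ J ⊔ Ideal.span (Set.range y))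
    {p : ℕ} (hp : p + l < n) (j : ℤ) : F.RowExact p j := by
  have huniv : initialIdx l l = Set.univ := Set.eq_univ_of_forall fun _ i _ => i.2
  have hle : J ⊔ Ideal.span (Set.range y) ≤ F.nullIdeal y Set.univ := by
    refine sup_le (fun a ha => ?_) (Ideal.span_le.2 ?_)
    · obtain ⟨H, h0, h1⟩ := FreeSeq.exists_homotopy hF (hJ a ha)
      exact FreeSeq.mem_nullIdeal_of_homotopy h0 h1
    · rintro _ ⟨i, rfl⟩
      exact FreeSeq.mem_nullIdeal_of_wedge i fun _ _ _ _ => trivial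
  -- Here k counts the generators already removed; each lowers the range of exactness by one.
  have key : ∀ k ≤ l, ∀ q : ℤ, q + k < n → ∀ j,
      F.RelExact y d (initialIdx l (l - k)) Set.univ (nonnegSome n n) q j := by
    intro k
    induction k with
    | zero =>
      intro _ q hq j
      have := FreeSeq.relExact_top_of_lt (F := F) (Ω := initialIdx l l) hy
        (lowerIdx_initialIdx l l) (fun i => by
          rw [huniv]; obtain ⟨N, hN⟩ := hm i; exact ⟨N, hle hN⟩) (q := q) (j := j)
          (by simpa using hq)
      rwa [nonnegFrom_self] at this
    | succ k ih =>
      intro hk q hq j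
      refine FreeSeq.relExact_initialIdx hy hd (r := l - (k + 1)) (by omega) ?_ j
      intro j
      rw [show l - (k + 1) + 1 = l - k by omega]
      exact ih (by omega) _ (by push_cast at hq; omega) j
  intro v hv hdv
  have hex := key l le_rfl p (by omega) j
  rw [Nat.sub_self] at hex
  -- With no Koszul generators left, the complex is `F` itself, placed at the empty subset.
  set z : F.Tot l (Laurent K n) := Pi.single ∅ (Pi.single p (v p)) with hz
  have hempty : ∀ {s : Finset (Fin l)} {q : ℕ}, (s, q) ∈ initialIdx l 0 → s = ∅ := fun h =>
    Finset.eq_empty_of_forall_notMem fun i hi => absurd (h i hi) (by simp)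
  have hzero : ∀ (z : F.Tot l (Laurent K n)) s, (∀ t ≠ ∅, z t = 0) → F.totD y _ z s =
      ((-1) ^ s.card : Poly K n) • F.diff _ (z s) := by
    intro z s h
    rw [F.totD_apply, kosD_apply, Finset.sum_eq_zero, zero_add]
    intro i _
    rw [h _ (Finset.insert_ne_empty i s), smul_zero, ite_self]
  have hz0 : ∀ t ≠ ∅, z t = 0 := fun t ht => Pi.single_eq_of_ne ht _
  obtain ⟨b, hb, -, hzb⟩ := hex z (by
      intro s p' c
      by_cases hs : s = ∅
      · subst hs
        by_cases hp' : p' = p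
        · subst hp'
          rw [hz, Pi.single_eq_same, Pi.single_eq_same]
          refine supportedIn_mono ?_ (hv c)
          intro α hα
          refine ⟨fun i hi => absurd hi (Finset.notMem_empty i), by simp, ?_⟩
          simpa using hα
        · rw [hz, Pi.single_eq_same, Pi.single_eq_of_ne hp']
          exact zero_mem _
      · rw [hz0 s hs]; exact zero_mem _)
    (fun s p c => mem_supportedIn.2 fun _ _ => trivial) (by
      intro s p' c
      rw [hzero z s hz0]
      refine sign_smul_mem_supportedIn ?_ _
      by_cases hs : s = ∅
      · subst hs
        rw [hz, Pi.single_eq_same]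
        by_cases hp' : p' + 1 = p
        · have := hdv p' c hp'
          subst hp'
          rw [F.diff_apply] at this ⊢
          rwa [Pi.single_eq_same]
        · rw [FreeSeq.diff_single _ _ hp']; exact zero_mem _
      · rw [hz0 s hs, map_zero]; exact zero_mem _)
  refine ⟨b ∅ (p + 1), fun c => ?_, fun c => ?_⟩
  · refine supportedIn_mono ?_ (hb ∅ (p + 1) c)
    rintro α ⟨-, -, h⟩
    simpa using h
  · have := hzb ∅ p c
    have hb0 : ∀ t ≠ ∅, b t = 0 := fun t ht => by
      funext q
      exact FreeSeq.eq_zero_of_notMem hb fun h => ht (hempty h.1)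
    rw [Pi.sub_apply, Pi.sub_apply, Pi.sub_apply, hzero b ∅ hb0, hz, Pi.single_eq_same,
      Pi.single_eq_same, Finset.card_empty, pow_zero, one_smul, F.diff_apply] at this
    exact this

/-- The index set of the total complex of `K(x)` and the truncation `F_k → ⋯ → F_0`. -/
def truncIdx (l k : ℕ) : Set (Finset (Fin l) × ℕ) := {a | a.2 ≤ k}

theorem lowerIdx_truncIdx (l k : ℕ) : LowerIdx (truncIdx l k) :=
  ⟨fun _ _ _ _ h => h, fun _ _ h => (Nat.le_succ _).trans h⟩

/-- Exact rows allow the components of a cycle in rows 0, ..., k - 1 to be cleared successively by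
boundaries. What is left sits in row k with |s| = n, and the degree hypothesis makes it vanish in
top local cohomology. -/
theorem FreeSeq.relExact_top_of_degree {x : Fin l → Poly K n} {d : Fin l → ℕ}
    (hx : ∀ i, (x i).IsHomogeneous (d i)) {k : ℕ} (hrow : ∀ p < k, ∀ j, F.RowExact p j) {j : ℤ}
    (hj : ∀ s : Finset (Fin l), s.card = n → ∀ c,
      ∑ i ∈ s, (d i : ℤ) + F.shift k c < j + n) :
    F.RelExact x d (truncIdx l k) Set.univ (nonnegSome n n) (k + n) j := by
  intro z hz _ hDz
  have hsm : ∀ (a : Poly K n) {f : Laurent K n}, f ∈ supportedIn K (nonnegSome n n) →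
      a • f ∈ supportedIn K (nonnegSome n n) := fun a f hf =>
    smul_mem_supportedIn hf fun α hα β _ => upClosed_nonnegSome n n α hα _ (expEmb_nonneg β)
  have key : ∀ p ≤ k, ∃ b ∈ F.gr d (truncIdx l k) {j} (k + n + 1), ∀ s p' c, p' < p →
      (z - F.totD x _ b) s p' c ∈ supportedIn K (nonnegSome n n) := by
    intro p
    induction p with
    | zero => exact fun _ => ⟨0, zero_mem _, fun _ _ _ h => absurd h (Nat.not_lt_zero _)⟩
    | succ p ih =>
      intro hp
      obtain ⟨b, hb, hzb⟩ := ih (by omega)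
      set z' := z - F.totD x _ b with hz'
      have hz'g : z' ∈ F.gr d (truncIdx l k) {j} (k + n) :=
        sub_mem hz (FreeSeq.totD_mem_gr hx (lowerIdx_truncIdx l k) hb)
      have hDz' : F.totD x _ z' ∈ F.inSet l (nonnegSome n n) := by
        rw [hz', map_sub, F.totD_totD, sub_zero]; exact hDz
      have hu : ∀ s : Finset (Fin l), ∃ u : Fin (F.rank (p + 1)) → Laurent K n,
          (∀ c, u c ∈ supportedIn K {α | (s.card : ℤ) + p = k + n ∧
            ∑ i, α i + (∑ i ∈ s, (d i : ℤ) + F.shift (p + 1) c) = j}) ∧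
          ∀ c, z' s p c - ∑ b, F.mat p c b • u b ∈ supportedIn K (nonnegSome n n) := by
        intro s
        by_cases hs : (s.card : ℤ) + p = k + n
        -- The rows below p are already zero modulo W, so the Koszul part of D z' contributes
        -- nothing to row p - 1 and row p of z' is a cycle for the row differential.
        · obtain ⟨u, hu1, hu2⟩ := hrow p (by omega) (j - ∑ i ∈ s, (d i : ℤ)) (z' s) (by
              intro c
              refine supportedIn_mono ?_ (hz'g s p c)
              rintro α ⟨-, -, h⟩
              rw [Set.mem_singleton_iff] at h
              rw [Set.mem_ofPred_eq]; linarith) (by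
              rintro p' c rfl
              have h1 := hDz' s p' c
              rw [F.totD_apply, Pi.add_apply, Pi.add_apply] at h1
              have h2 : kosD x (F.Coeff (Laurent K n)) z' s p' c ∈
                  supportedIn K (nonnegSome n n) := by
                rw [kosD_apply, Finset.sum_apply, Finset.sum_apply]
                refine sum_mem fun i _ => ?_
                split_ifs
                · exact zero_mem _
                · exact hsm _ (hzb _ p' c (Nat.lt_succ_self _))
              have h3 := sub_mem h1 h2
              rw [add_sub_cancel_left] at h3
              have h4 := sign_smul_mem_supportedIn h3 s.card
              rwa [Pi.smul_apply, Pi.smul_apply, smul_smul, ← mul_pow, neg_one_mul, neg_neg,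
                one_pow, one_smul] at h4)
          refine ⟨u, fun c => supportedIn_mono ?_ (hu1 c), hu2⟩
          intro α hα
          rw [Set.mem_ofPred_eq] at hα
          exact ⟨hs, by linarith⟩
        · refine ⟨0, fun c => zero_mem _, fun c => ?_⟩
          rw [FreeSeq.eq_zero_of_notMem hz'g (s := s) (p := p) fun h => hs h.2]
          simp only [Pi.zero_apply, smul_zero, Finset.sum_const_zero, sub_zero]
          exact zero_mem _
      choose u hu1 hu2 using hu
      set b' : F.Tot l (Laurent K n) :=
        fun s => Pi.single (p + 1) (((-1) ^ s.card : Poly K n) • u s)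
      have hb' : ∀ s, b' s = Pi.single (p + 1) (((-1) ^ s.card : Poly K n) • u s) := fun _ => rfl
      refine ⟨b + b', add_mem hb ?_, ?_⟩
      · intro s p' c
        by_cases hp' : p' = p + 1
        · subst hp'
          rw [hb', Pi.single_eq_same]
          refine sign_smul_mem_supportedIn (supportedIn_mono ?_ (hu1 s c)) _
          rintro α ⟨h1, h2⟩
          exact ⟨hp, by push_cast; linarith, h2⟩
        · rw [hb', Pi.single_eq_of_ne hp']; exact zero_mem _
      · intro s p' c hp'
        have e1 : (z - F.totD x _ (b + b')) s p' c = z' s p' c - F.totD x _ b' s p' c := by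
          rw [map_add, ← sub_sub]; rfl
        have e2 : F.totD x _ b' s p' c =
            ((-1) ^ s.card : Poly K n) • F.diff _ (b' s) p' c := by
          rw [F.totD_apply, Pi.add_apply, Pi.add_apply, kosD_apply, Finset.sum_apply,
            Finset.sum_apply, Finset.sum_eq_zero, zero_add, Pi.smul_apply, Pi.smul_apply]
          intro i _
          split_ifs
          · rfl
          · rw [Pi.smul_apply, Pi.smul_apply, hb',
              Pi.single_eq_of_ne (show p' ≠ p + 1 by omega), Pi.zero_apply, smul_zero]
        rw [e1, e2, hb']
        rcases Nat.lt_succ_iff_lt_or_eq.1 hp' with h | rfl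
        · rw [FreeSeq.diff_single _ _ (by omega), smul_zero, sub_zero]
          exact hzb s p' c h
        · rw [F.diff_apply, Pi.single_eq_same, Finset.smul_sum]
          have e3 : ∑ b, ((-1) ^ s.card : Poly K n) • F.mat p' c b •
              (((-1) ^ s.card : Poly K n) • u s) b = ∑ b, F.mat p' c b • u s b := by
            refine Finset.sum_congr rfl fun b _ => ?_
            rw [Pi.smul_apply, smul_comm, smul_smul _ _ (u s b), ← mul_pow, neg_one_mul, neg_neg,
              one_pow, one_smul]
          rw [e3]
          exact hu2 s c
  obtain ⟨b, hb, hzb⟩ := key k le_rfl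
  refine ⟨b, hb, fun _ _ _ => mem_supportedIn.2 fun _ _ => trivial, fun s p c => ?_⟩
  have hg : z - F.totD x _ b ∈ F.gr d (truncIdx l k) {j} (k + n) :=
    sub_mem hz (FreeSeq.totD_mem_gr hx (lowerIdx_truncIdx l k) hb)
  rcases lt_trichotomy p k with h | rfl | h
  · exact hzb s p c h
  · refine supportedIn_mono ?_ (hg s p c)
    rintro α ⟨-, h2, h3⟩
    rw [Set.mem_singleton_iff] at h3
    refine mem_nonnegSome_of_lt_sum ?_
    have := hj s (by omega) c
    linarith
  · rw [FreeSeq.eq_zero_of_notMem hg (s := s) (p := p) fun h' => absurd h'.1 (not_le.2 h)]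
    exact zero_mem _

end DegreeBound

/-! ### Homogeneous primes and homogeneous parameters -/

section Parameters

attribute [local instance] MvPolynomial.gradedAlgebra

variable {K : Type*} [Field K] {n : ℕ}

/-- Homogeneous ideals of the polynomial ring. -/
def HomogIdeal (J : Ideal (Poly K n)) : Prop :=
  J.IsHomogeneous (MvPolynomial.homogeneousSubmodule (Fin n) K)

/-- The irrelevant ideal. -/
def irrIdeal (K : Type*) [Field K] (n : ℕ) : Ideal (Poly K n) :=
  Ideal.span (Set.range MvPolynomial.X)

theorem mem_irrIdeal {f : Poly K n} : f ∈ irrIdeal K n ↔ MvPolynomial.constantCoeff f = 0 := by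
  constructor
  · intro h
    have : irrIdeal K n ≤ RingHom.ker (MvPolynomial.constantCoeff (R := K) (σ := Fin n)) := by
      rw [irrIdeal, Ideal.span_le]
      rintro _ ⟨i, rfl⟩
      simp [RingHom.mem_ker]
    exact this h
  · intro h
    rw [irrIdeal, ← Set.image_univ, MvPolynomial.mem_ideal_span_X_image]
    intro β hβ
    by_contra hc
    push Not at hc
    have : β = 0 := by ext i; simpa using hc i (Set.mem_univ i)
    rw [this, MvPolynomial.mem_support_iff] at hβ
    exact hβ h

theorem irrIdeal_isPrime : (irrIdeal K n).IsPrime := by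
  have : irrIdeal K n = RingHom.ker (MvPolynomial.constantCoeff (R := K) (σ := Fin n)) := by
    ext f; exact mem_irrIdeal
  rw [this]; exact RingHom.ker_isPrime _

theorem HomogIdeal.le_irrIdeal {Q : Ideal (Poly K n)} (hQ : HomogIdeal Q) (h : Q ≠ ⊤) :
    Q ≤ irrIdeal K n := by
  intro f hf
  rw [mem_irrIdeal]
  by_contra hc
  have h1 := MvPolynomial.homogeneousComponent_mem_of_mem hQ hf 0
  rw [MvPolynomial.homogeneousComponent_zero] at h1
  refine h (Ideal.eq_top_of_isUnit_mem _ h1 ?_)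
  exact (isUnit_iff_ne_zero.2 hc).map MvPolynomial.C

/-- The homogeneous core of P is a prime still containing J, so minimality forces it to equal P. -/
theorem HomogIdeal.minimalPrimes {J : Ideal (Poly K n)} (hJ : HomogIdeal J) {P : Ideal (Poly K n)}
    (hP : P ∈ J.minimalPrimes) : HomogIdeal P := by
  have h1 := hP.1.1.homogeneousCore (𝒜 := MvPolynomial.homogeneousSubmodule (Fin n) K)
  have h2 := Ideal.toIdeal_homogeneousCore_le
    (MvPolynomial.homogeneousSubmodule (Fin n) K) P
  have h3 : J ≤ (P.homogeneousCore (MvPolynomial.homogeneousSubmodule (Fin n) K)).toIdeal := by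
    rw [← hJ.toIdeal_homogeneousCore_eq_self]
    exact Ideal.homogeneousCore_mono _ hP.1.2
  have h4 := le_antisymm h2 (hP.2 ⟨h1, h3⟩ h2)
  rw [HomogIdeal, ← h4]
  exact (P.homogeneousCore _).isHomogeneous

theorem HomogIdeal.span {s : Set (Poly K n)} (h : ∀ f ∈ s, ∃ d, f.IsHomogeneous d) :
    HomogIdeal (Ideal.span s) :=
  Ideal.homogeneous_span _ _ fun f hf => h f hf

theorem HomogIdeal.exists_notMem {P Q : Ideal (Poly K n)} (hP : HomogIdeal P) (h : ¬ P ≤ Q) :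
    ∃ f ∈ P, f ∉ Q ∧ ∃ d, f.IsHomogeneous d := by
  obtain ⟨f, hf, hfQ⟩ := Set.not_subset.1 h
  by_contra hc
  push Not at hc
  refine hfQ ?_
  rw [← MvPolynomial.sum_homogeneousComponent f]
  refine Ideal.sum_mem _ fun d _ => ?_
  by_contra hd
  exact hc _ (MvPolynomial.homogeneousComponent_mem_of_mem hP hf d) hd d
    (MvPolynomial.homogeneousComponent_isHomogeneous d f)

theorem exists_X_notMem {Q : Ideal (Poly K n)} (h : ¬ irrIdeal K n ≤ Q) :
    ∃ i, MvPolynomial.X i ∉ Q := by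
  by_contra hc
  push Not at hc
  refine h (Ideal.span_le.2 ?_)
  rintro _ ⟨i, rfl⟩
  exact hc i

/-- Homogeneous prime avoidance. -/
theorem exists_homogeneous_notMem (s : Finset (Ideal (Poly K n)))
    (hs : ∀ P ∈ s, HomogIdeal P ∧ P.IsPrime ∧ ¬ irrIdeal K n ≤ P) :
    ∃ (f : Poly K n) (d : ℕ), f.IsHomogeneous d ∧ 0 < d ∧ ∀ P ∈ s, f ∉ P := by
  classical
  induction s using Finset.induction_on with
  | empty => exact ⟨0, 1, MvPolynomial.isHomogeneous_zero _ _ _, one_pos, by simp⟩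
  | insert P s _ ih =>
    obtain ⟨f, d, hf, hd, hfs⟩ := ih fun Q hQ => hs Q (Finset.mem_insert_of_mem hQ)
    obtain ⟨-, hP, hPm⟩ := hs P (Finset.mem_insert_self _ _)
    by_cases hfP : f ∈ P
    · have hg : ∃ (g : Poly K n) (e : ℕ), g.IsHomogeneous e ∧ 0 < e ∧ g ∉ P ∧
          ∀ Q ∈ s, ¬ Q ≤ P → g ∈ Q := by
        have hex : ∀ Q ∈ s, ∃ a : Poly K n, a ∉ P ∧ (∃ d, a.IsHomogeneous d) ∧
            (¬ Q ≤ P → a ∈ Q) := by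
          intro Q hQ
          by_cases hQP : Q ≤ P
          · exact ⟨1, (Ideal.ne_top_iff_one P).1 hP.ne_top, ⟨0, MvPolynomial.isHomogeneous_one _ _⟩,
              fun h => absurd hQP h⟩
          · obtain ⟨a, h1, h2, h3⟩ :=
              (hs Q (Finset.mem_insert_of_mem hQ)).1.exists_notMem hQP
            exact ⟨a, h2, h3, fun _ => h1⟩
        choose! a ha1 ha2 ha3 using hex
        choose! e he using ha2
        obtain ⟨i, hi⟩ := exists_X_notMem hPm
        -- The factor X_i, chosen outside P, guarantees positive degree even if all other factors
        -- are 1.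
        refine ⟨MvPolynomial.X i * ∏ Q ∈ s, a Q, 1 + ∑ Q ∈ s, e Q,
          (MvPolynomial.isHomogeneous_X K i).mul (MvPolynomial.IsHomogeneous.prod s a e he),
          by omega, ?_, ?_⟩
        · rw [hP.mul_mem_iff_mem_or_mem, not_or]
          refine ⟨hi, ?_⟩
          rw [hP.prod_mem_iff]
          push Not
          exact ha1
        · intro Q hQ hQP
          exact Ideal.mul_mem_left _ _ (Ideal.mem_of_dvd _ (Finset.dvd_prod_of_mem a hQ)
            (ha3 Q hQ hQP))
      obtain ⟨g, e, hg, he, hgP, hgs⟩ := hg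
      have hnotP : f ^ e + g ^ d ∉ P := by
        intro h
        have h1 := (Ideal.add_mem_iff_right P (Ideal.pow_mem_of_mem P hfP e he)).1 h
        exact hgP (hP.mem_of_pow_mem _ h1)
      -- The powers equalize the degrees. For Q ≤ P avoidance of Q follows from that of P; otherwise
      -- g lies in Q and f does not.
      refine ⟨f ^ e + g ^ d, d * e, (hf.pow e).add (by rw [mul_comm]; exact hg.pow d),
        Nat.mul_pos hd he, ?_⟩
      intro Q hQ
      rcases Finset.mem_insert.1 hQ with rfl | hQ
      · exact hnotP
      · by_cases hQP : Q ≤ P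
        · exact fun h => hnotP (hQP h)
        · intro h
          have h1 := (Ideal.add_mem_iff_left Q
            (Ideal.pow_mem_of_mem Q (hgs Q hQ hQP) d hd)).1 h
          exact hfs Q hQ ((hs Q (Finset.mem_insert_of_mem hQ)).2.1.mem_of_pow_mem _ h1)
    · refine ⟨f, d, hf, hd, fun Q hQ => ?_⟩
      rcases Finset.mem_insert.1 hQ with rfl | hQ
      · exact hfP
      · exact hfs Q hQ

/-- The radical of J is the intersection of its minimal primes, which are homogeneous and hence all
equal to the irrelevant ideal. -/
theorem exists_X_pow_mem {J : Ideal (Poly K n)} (hJ : HomogIdeal J)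
    (h : ∀ Q : Ideal (Poly K n), Q.IsPrime → HomogIdeal Q → J ≤ Q → Q = irrIdeal K n) (i : Fin n) :
    ∃ N, MvPolynomial.X i ^ N ∈ J := by
  have : MvPolynomial.X i ∈ J.radical := by
    rw [← J.sInf_minimalPrimes, Ideal.mem_sInf]
    intro P hP
    rw [h P hP.1.1 (hJ.minimalPrimes hP) hP.1.2]
    exact Ideal.subset_span ⟨i, rfl⟩
  exact this

theorem height_le_of_ne_top {Q : Ideal (Poly K n)} (hQ : Q ≠ ⊤) : Q.height ≤ n := by
  have h1 := Ideal.height_le_ringKrullDim_of_ne_top hQ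
  rw [MvPolynomial.ringKrullDim_of_isNoetherianRing, ringKrullDim_eq_zero_of_field, zero_add,
    Nat.card_fin] at h1
  exact_mod_cast h1

/-- Adjoining an f that avoids the minimal primes of J other than the irrelevant ideal raises the
height of every relevant homogeneous prime by one. Listing the irrelevant ideal as an exception
avoids any lower bound for its height; only `height_le_of_ne_top` is used. -/
theorem exists_parameters_aux (t : ℕ) : ∀ (k : ℕ) (J : Ideal (Poly K n)), k + t = n →
    HomogIdeal J →
    (∀ Q : Ideal (Poly K n), Q.IsPrime → HomogIdeal Q → J ≤ Q →
      Q = irrIdeal K n ∨ (k : ℕ∞) ≤ Q.height) →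
    ∃ (y : Fin t → Poly K n) (d : Fin t → ℕ), (∀ i, (y i).IsHomogeneous (d i)) ∧
      (∀ i, 0 < d i) ∧ ∀ i : Fin n, ∃ N, MvPolynomial.X i ^ N ∈ J ⊔ Ideal.span (Set.range y) := by
  classical
  induction t with
  | zero =>
    intro k J hk hJ h
    refine ⟨Fin.elim0, Fin.elim0, fun i => i.elim0, fun i => i.elim0, fun i => ?_⟩
    obtain ⟨N, hN⟩ := exists_X_pow_mem hJ (fun Q hQ hQh hJQ => by
      rcases h Q hQ hQh hJQ with h | hht
      · exact h
      · by_contra hne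
        have := irrIdeal_isPrime (K := K) (n := n)
        have h1 := Ideal.height_add_one_le_of_lt_of_isPrime
          -- A prime of height at least n strictly inside the irrelevant ideal would give that ideal
          -- height at least n + 1.
          (lt_of_le_of_ne (hQh.le_irrIdeal hQ.ne_top) hne)
        have h2 : (n : ℕ∞) + 1 ≤ n := (add_le_add_left (by simpa [← hk] using hht) 1).trans
          (h1.trans (height_le_of_ne_top irrIdeal_isPrime.ne_top))
        exact absurd h2 (by norm_cast; omega)) i
    exact ⟨N, Ideal.mem_sup_left hN⟩
  | succ t ih =>
    intro k J hk hJ h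
    obtain ⟨f, d, hf, hd, hfs⟩ := exists_homogeneous_notMem
      (J.finite_minimalPrimes_of_isNoetherianRing.toFinset.filter (¬ irrIdeal K n ≤ ·)) (by
        intro P hP
        rw [Finset.mem_filter, Set.Finite.mem_toFinset] at hP
        exact ⟨hJ.minimalPrimes hP.1, hP.1.1.1, hP.2⟩)
    obtain ⟨y, e, hy, he, hX⟩ := ih (k + 1) (J ⊔ Ideal.span {f}) (by omega)
      (Ideal.IsHomogeneous.sup hJ (HomogIdeal.span (by simpa using ⟨d, hf⟩))) (by
        intro Q hQ hQh hJQ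
        obtain ⟨P, hP, hPQ⟩ := Ideal.exists_minimalPrimes_le (le_sup_left.trans hJQ)
        by_cases hPm : irrIdeal K n ≤ P
        · exact Or.inl (le_antisymm (hQh.le_irrIdeal hQ.ne_top) (hPm.trans hPQ))
        · right
          have hfP : f ∉ P := hfs P (by
            rw [Finset.mem_filter, Set.Finite.mem_toFinset]; exact ⟨hP, hPm⟩)
          have hfQ : f ∈ Q := hJQ (Ideal.mem_sup_right (Ideal.mem_span_singleton_self f))
          have hlt : P < Q := lt_of_le_of_ne hPQ fun h => hfP (h ▸ hfQ)
          have := hP.1.1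
          have h1 := Ideal.height_add_one_le_of_lt_of_isPrime hlt
          have h2 : (k : ℕ∞) ≤ P.height :=
            (h P hP.1.1 (hJ.minimalPrimes hP) hP.1.2).resolve_left fun h => hPm h.ge
          push_cast
          exact (add_le_add_left h2 1).trans h1)
    refine ⟨Fin.cons f y, Fin.cons d e, ?_, ?_, fun i => ?_⟩
    · intro i; refine Fin.cases ?_ (fun i => ?_) i
      · simpa using hf
      · simpa using hy i
    · intro i; refine Fin.cases ?_ (fun i => ?_) i
      · simpa using hd
      · simpa using he i
    · obtain ⟨N, hN⟩ := hX i
      refine ⟨N, ?_⟩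
      rwa [Fin.range_cons, Set.insert_eq, Ideal.span_union, ← sup_assoc]

/-- A homogeneous ideal of height at least `k` and `n - k` suitable homogeneous elements generate
an ideal containing powers of all the variables. -/
theorem exists_parameters {J : Ideal (Poly K n)} (hJ : HomogIdeal J) {k t : ℕ} (hk : k + t = n)
    (hht : (k : ℕ∞) ≤ J.height) :
    ∃ (y : Fin t → Poly K n) (d : Fin t → ℕ), (∀ i, (y i).IsHomogeneous (d i)) ∧
      (∀ i, 0 < d i) ∧ ∀ i : Fin n, ∃ N, MvPolynomial.X i ^ N ∈ J ⊔ Ideal.span (Set.range y) :=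
  exists_parameters_aux t k J hk hJ fun _ _ _ h => Or.inr (hht.trans (Ideal.height_mono h))

theorem exists_X_pow_mem_of_ringKrullDim {J : Ideal (Poly K n)} (hJ : HomogIdeal J)
    (h : ringKrullDim (Poly K n ⧸ J) = 0) (i : Fin n) : ∃ N, MvPolynomial.X i ^ N ∈ J := by
  refine exists_X_pow_mem hJ (fun Q hQ hQh hJQ => ?_) i
  have : Ring.KrullDimLE 0 (Poly K n ⧸ J) := Ring.krullDimLE_iff.2 h.le
  have h1 : (Q.map (Ideal.Quotient.mk J)).IsPrime :=
    Ideal.map_isPrime_of_surjective Ideal.Quotient.mk_surjective (by simpa using hJQ)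
  have h2 := h1.isMaximal'
  have h3 := Ideal.comap_isMaximal_of_surjective (Ideal.Quotient.mk J)
    Ideal.Quotient.mk_surjective (K := Q.map (Ideal.Quotient.mk J))
  rw [Ideal.comap_map_of_surjective _ Ideal.Quotient.mk_surjective, ← RingHom.ker_eq_comap_bot,
    Ideal.mk_ker, sup_eq_left.2 hJQ] at h3
  exact h3.eq_of_le irrIdeal_isPrime.ne_top (hQh.le_irrIdeal hQ.ne_top)

end Parameters

/-! ### Projections onto homogeneous components and minimal generators -/

section GradedProjections

variable {K : Type*} [Field K] {n : ℕ}

/-- The homogeneous component of degree `e : ℤ` of a polynomial. -/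
def polyComp (K : Type*) [Field K] (n : ℕ) : ℤ → Poly K n →+ Poly K n
  | Int.ofNat d => (MvPolynomial.homogeneousComponent d).toAddMonoidHom
  | Int.negSucc _ => 0

theorem mem_polyGrading_iff {e : ℤ} {p : Poly K n} :
    p ∈ polyGrading K n e ↔ ∀ β ∈ p.support, (β.degree : ℤ) = e := by
  cases e with
  | ofNat d =>
    change p.IsHomogeneous d ↔ _
    constructor
    · intro h β hβ
      have h1 := h (MvPolynomial.mem_support_iff.1 hβ)
      have h2 : β.degree = d := by rw [Finsupp.degree_eq_weight_one]; exact h1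
      exact congrArg Int.ofNat h2
    · intro h β hβ
      have h1 : β.degree = d := Int.ofNat.inj (h β (MvPolynomial.mem_support_iff.2 hβ))
      rw [Finsupp.degree_eq_weight_one] at h1
      exact h1
  | negSucc d =>
    change p = 0 ↔ _
    constructor
    · rintro rfl β hβ
      simp at hβ
    · intro h
      by_contra hp
      obtain ⟨β, hβ⟩ := Finset.nonempty_of_ne_empty (MvPolynomial.support_eq_empty.not.2 hp)
      have := h β hβ
      omega

theorem polyComp_mem (e : ℤ) (p : Poly K n) : polyComp K n e p ∈ polyGrading K n e := by
  cases e with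
  | ofNat d => exact MvPolynomial.homogeneousComponent_isHomogeneous d p
  | negSucc d => exact zero_mem _

theorem polyComp_of_mem {e : ℤ} {p : Poly K n} (hp : p ∈ polyGrading K n e) (e' : ℤ) :
    polyComp K n e' p = if e' = e then p else 0 := by
  cases e with
  | ofNat d =>
    cases e' with
    | ofNat d' =>
      change MvPolynomial.homogeneousComponent d' p = _
      rw [MvPolynomial.homogeneousComponent_of_mem hp]
      simp
    | negSucc d' => exact (if_neg (by simp)).symm
  | negSucc d =>
    have : p = 0 := hp
    rw [this, map_zero, ite_self]

theorem polyComp_zero (p : Poly K n) :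
    polyComp K n 0 p = MvPolynomial.C (MvPolynomial.constantCoeff p) :=
  MvPolynomial.homogeneousComponent_zero p

theorem sum_polyComp (p : Poly K n) :
    ∑ d ∈ Finset.range (p.totalDegree + 1), polyComp K n d p = p :=
  MvPolynomial.sum_homogeneousComponent p

/-- A grading of a module given by its projections onto the homogeneous components. -/
structure GradedProj (K : Type*) [Field K] (n : ℕ) {M : Type*} [AddCommGroup M] [Module (Poly K n) M]
    (𝓜 : ℤ → AddSubgroup M) where
  proj : ℤ → M →+ M
  mem : ∀ j m, proj j m ∈ 𝓜 j
  of_mem : ∀ {i m}, m ∈ 𝓜 i → ∀ j, proj j m = if j = i then m else 0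
  exists_sum : ∀ m, ∃ s : Finset ℤ, ∑ j ∈ s, proj j m = m
  smul_mem : ∀ (d : ℕ) (j : ℤ) (p : Poly K n) (m : M),
    p.IsHomogeneous d → m ∈ 𝓜 j → p • m ∈ 𝓜 (d + j)

variable {M : Type*} [AddCommGroup M] [Module (Poly K n) M] {𝓜 : ℤ → AddSubgroup M}

/-- The projections of a graded module. -/
def IsGradedModule.gradedProj (h : IsGradedModule K n 𝓜) : GradedProj K n 𝓜 :=
  letI := h.isInternal.chooseDecomposition
  { proj := fun j => (𝓜 j).subtype.comp
      ((DFinsupp.evalAddMonoidHom j).comp (DirectSum.decomposeAddEquiv 𝓜).toAddMonoidHom)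
    mem := fun j m => (DirectSum.decompose 𝓜 m j).2
    of_mem := by
      intro i m hm j
      change (DirectSum.decompose 𝓜 m j : M) = _
      split_ifs with hj
      · subst hj; exact DirectSum.decompose_of_mem_same 𝓜 hm
      · exact DirectSum.decompose_of_mem_ne 𝓜 hm (Ne.symm hj)
    exists_sum := fun m => by
      classical exact ⟨_, DirectSum.sum_support_decompose 𝓜 m⟩
    smul_mem := h.smul_mem }

theorem GradedProj.smul_mem_int (G : GradedProj K n 𝓜) {e j : ℤ} {p : Poly K n} {m : M} (hp : p ∈ polyGrading K n e)
    (hm : m ∈ 𝓜 j) : p • m ∈ 𝓜 (e + j) := by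
  cases e with
  | ofNat d => exact G.smul_mem d j p m hp hm
  | negSucc d =>
    have : p = 0 := hp
    rw [this, zero_smul]; exact zero_mem _

theorem GradedProj.proj_smul (G : GradedProj K n 𝓜) {a : ℤ} {m : M} (hm : m ∈ 𝓜 a) (p : Poly K n) (j : ℤ) :
    G.proj j (p • m) = polyComp K n (j - a) p • m := by
  conv_lhs => rw [← sum_polyComp p, Finset.sum_smul, map_sum]
  conv_rhs => rw [← sum_polyComp p, map_sum, Finset.sum_smul]
  refine Finset.sum_congr rfl fun d _ => ?_
  rw [G.of_mem (G.smul_mem_int (polyComp_mem d p) hm), polyComp_of_mem (polyComp_mem d p)]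
  by_cases h : j = d + a
  · rw [if_pos h, if_pos (by omega)]
  · rw [if_neg h, if_neg (by omega), zero_smul]

/-- The annihilator of a graded module is homogeneous. -/
theorem GradedProj.homogIdeal_annihilator (G : GradedProj K n 𝓜) : HomogIdeal (Module.annihilator (Poly K n) M) := by
  intro d p hp
  have h1 : MvPolynomial.homogeneousComponent d p ∈ Module.annihilator (Poly K n) M := by
    rw [Module.mem_annihilator] at hp ⊢
    intro m
    obtain ⟨s, hs⟩ := G.exists_sum m
    rw [← hs, Finset.smul_sum]
    refine Finset.sum_eq_zero fun j _ => ?_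
    have h2 := G.proj_smul (G.mem j m) p (d + j)
    rw [hp, map_zero, add_sub_cancel_right] at h2
    exact h2.symm
  have h3 := MvPolynomial.decomposition.decompose'_apply p d
  rw [← h3] at h1
  exact h1

/-- The projections of a graded free module. -/
def freeGradedProj {r : ℕ} (a : Fin r → ℤ) : GradedProj K n (shiftedPi a (polyGrading K n)) where
  proj j :=
    { toFun := fun v c => polyComp K n (j - a c) (v c)
      map_zero' := by funext c; exact map_zero _
      map_add' := fun u v => by funext c; exact map_add _ _ _ }
  mem j v := fun c _ => polyComp_mem _ _
  of_mem {i v} hv j := by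
    funext c
    change polyComp K n (j - a c) (v c) = _
    rw [polyComp_of_mem (hv c trivial)]
    by_cases h : j = i
    · rw [if_pos (by omega), if_pos h]
    · rw [if_neg (by omega), if_neg h]; rfl
  exists_sum v := by
    classical
    refine ⟨Finset.univ.biUnion fun c => (Finset.range ((v c).totalDegree + 1)).image
      fun d : ℕ => (d : ℤ) + a c, ?_⟩
    funext c
    rw [Finset.sum_apply]
    change ∑ j ∈ _, polyComp K n (j - a c) (v c) = _
    conv_rhs => rw [← sum_polyComp (v c)]
    rw [← Finset.sum_subset (Finset.subset_biUnion_of_mem (fun c =>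
      (Finset.range ((v c).totalDegree + 1)).image fun d : ℕ => (d : ℤ) + a c) (Finset.mem_univ c)),
      Finset.sum_image]
    · exact Finset.sum_congr rfl fun d _ => by rw [add_sub_cancel_right]
    · intro d _ d' _ h
      simpa using h
    · intro j _ hj
      rw [← sum_polyComp (v c), map_sum]
      refine Finset.sum_eq_zero fun d hd => ?_
      rw [polyComp_of_mem (polyComp_mem d _), if_neg]
      intro h
      exact hj (Finset.mem_image.2 ⟨d, hd, by omega⟩)
  smul_mem d j p v hp hv := fun c _ => by
    change p * v c ∈ polyGrading K n (d + j - a c)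
    rw [add_sub_assoc]
    cases hjc : j - a c with
    | ofNat e =>
      have : v c ∈ polyGrading K n (j - a c) := hv c trivial
      rw [hjc] at this
      exact MvPolynomial.IsHomogeneous.mul hp this
    | negSucc e =>
      have : v c ∈ polyGrading K n (j - a c) := hv c trivial
      rw [hjc] at this
      have h0 : v c = 0 := this
      rw [h0, mul_zero]
      exact zero_mem _

/-- A submodule closed under taking homogeneous components. -/
def GradedProj.IsHomog (G : GradedProj K n 𝓜) (N : Submodule (Poly K n) M) : Prop := ∀ m ∈ N, ∀ j, G.proj j m ∈ N

theorem GradedProj.proj_linearCombination (G : GradedProj K n 𝓜) {r : ℕ} {a : Fin r → ℤ} {g : Fin r → M}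
    (hg : ∀ c, g c ∈ 𝓜 (a c)) (v : Fin r → Poly K n) (j : ℤ) :
    G.proj j (Fintype.linearCombination (Poly K n) g v) =
      Fintype.linearCombination (Poly K n) g ((freeGradedProj a).proj j v) := by
  rw [Fintype.linearCombination_apply, Fintype.linearCombination_apply, map_sum]
  exact Finset.sum_congr rfl fun c _ => G.proj_smul (hg c) _ _

theorem GradedProj.linearCombination_mem (G : GradedProj K n 𝓜) {r : ℕ} {a : Fin r → ℤ} {g : Fin r → M}
    (hg : ∀ c, g c ∈ 𝓜 (a c)) {j : ℤ} {v : Fin r → Poly K n}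
    (hv : v ∈ shiftedPi a (polyGrading K n) j) :
    Fintype.linearCombination (Poly K n) g v ∈ 𝓜 j := by
  rw [Fintype.linearCombination_apply]
  refine sum_mem fun c _ => ?_
  have : v c • g c ∈ 𝓜 (j - a c + a c) := G.smul_mem_int (hv c trivial) (hg c)
  rwa [sub_add_cancel] at this

theorem GradedProj.exists_homogeneous_generators (G : GradedProj K n 𝓜) [IsNoetherian (Poly K n) M]
    {N : Submodule (Poly K n) M} (hN : G.IsHomog N) :
    ∃ (r : ℕ) (a : Fin r → ℤ) (g : Fin r → M), (∀ c, g c ∈ 𝓜 (a c)) ∧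
      Submodule.span (Poly K n) (Set.range g) = N := by
  classical
  have h1 : N = Submodule.span (Poly K n) {m | m ∈ N ∧ ∃ j, m ∈ 𝓜 j} := by
    refine le_antisymm (fun m hm => ?_) (Submodule.span_le.2 fun m hm => hm.1)
    obtain ⟨s, hs⟩ := G.exists_sum m
    rw [← hs]
    exact sum_mem fun j _ => Submodule.subset_span ⟨hN m hm j, j, G.mem j m⟩
  have h2 : N.FG := IsNoetherian.noetherian N
  rw [h1] at h2
  obtain ⟨t, ht, ht'⟩ := Submodule.fg_span_iff_fg_span_finset_subset _ |>.1 h2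
  have h3 : ∀ m : t, ∃ j, (m : M) ∈ 𝓜 j := fun m => (ht m.2).2
  choose a ha using h3
  let e := t.equivFin
  refine ⟨t.card, fun c => a (e.symm c), fun c => (e.symm c : M), fun c => ha _, ?_⟩
  have h4 : Set.range (fun c => (e.symm c : M)) = (t : Set M) := by
    ext m
    constructor
    · rintro ⟨c, rfl⟩; exact (e.symm c).2
    · intro hm; exact ⟨e ⟨m, hm⟩, by simp⟩
  rw [h4, ← ht', ← h1]

/-- A homogeneous submodule has a minimal system of homogeneous generators. -/
theorem GradedProj.exists_minimal_generators (G : GradedProj K n 𝓜) [IsNoetherian (Poly K n) M]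
    {N : Submodule (Poly K n) M} (hN : G.IsHomog N) :
    ∃ (r : ℕ) (a : Fin r → ℤ) (g : Fin r → M), (∀ c, g c ∈ 𝓜 (a c)) ∧
      LinearMap.range (Fintype.linearCombination (Poly K n) g) = N ∧
      ∀ v, Fintype.linearCombination (Poly K n) g v = 0 →
        ∀ c, MvPolynomial.constantCoeff (v c) = 0 := by
  classical
  have hex := G.exists_homogeneous_generators hN
  -- Minimality means the fewest homogeneous generators; a relation with a unit constant coefficient
  -- would make one of them superfluous.
  obtain ⟨a, g, hg, hspan⟩ := Nat.find_spec hex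
  have hmin := fun m => Nat.find_min hex (m := m)
  generalize Nat.find hex = r at *
  refine ⟨r, a, g, hg, by rw [Fintype.range_linearCombination, hspan], fun v hv c => ?_⟩
  by_contra hc
  obtain _ | r := r
  · exact c.elim0
  refine hmin r (Nat.lt_succ_self r)
    ⟨fun i => a (c.succAbove i), fun i => g (c.succAbove i), fun i => hg _, ?_⟩
  refine le_antisymm ?_ ?_
  · rw [← hspan]
    refine Submodule.span_mono ?_
    rintro _ ⟨i, rfl⟩
    exact ⟨_, rfl⟩
  · rw [← hspan, Submodule.span_le]
    have hsub : ∀ i, g (c.succAbove i) ∈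
        Submodule.span (Poly K n) (Set.range fun i => g (c.succAbove i)) :=
      fun i => Submodule.subset_span ⟨i, rfl⟩
    rintro _ ⟨i, rfl⟩
    rcases Fin.eq_self_or_eq_succAbove c i with rfl | ⟨i, rfl⟩
    · have h1 := G.proj_linearCombination hg v (a i)
      rw [hv, map_zero, Fintype.linearCombination_apply, Fin.sum_univ_succAbove _ i] at h1
      have h2 : (freeGradedProj a).proj (a i) v i =
          MvPolynomial.C (MvPolynomial.constantCoeff (v i)) := by
        change polyComp K n (a i - a i) (v i) = _
        rw [sub_self, polyComp_zero]
      rw [h2] at h1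
      have h3 : g i = (MvPolynomial.C (MvPolynomial.constantCoeff (v i))⁻¹ : Poly K n) •
          ((MvPolynomial.C (MvPolynomial.constantCoeff (v i)) : Poly K n) • g i) := by
        rw [smul_smul, ← MvPolynomial.C_mul, inv_mul_cancel₀ hc, MvPolynomial.C_1, one_smul]
      rw [SetLike.mem_coe, h3, eq_neg_of_add_eq_zero_left h1.symm]
      exact Submodule.smul_mem _ _ (neg_mem (sum_mem fun k _ => Submodule.smul_mem _ _ (hsub k)))
    · exact hsub i

end GradedProjections

/-! ### Minimal graded free resolutions -/

section MinimalResolution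

variable {K : Type*} [Field K] {n : ℕ}

/-- A homogeneous submodule of a graded free module contained in `S_+` times that module. -/
structure MinSubmodule (K : Type*) [Field K] (n : ℕ) where
  rank : ℕ
  shift : Fin rank → ℤ
  sub : Submodule (Poly K n) (Fin rank → Poly K n)
  homog : (freeGradedProj shift).IsHomog sub
  min : ∀ v ∈ sub, ∀ c, MvPolynomial.constantCoeff (v c) = 0

variable {M : Type*} [AddCommGroup M] [Module (Poly K n) M] {𝓜 : ℤ → AddSubgroup M}

theorem GradedProj.exists_minimal_cover [IsNoetherian (Poly K n) M] (G : GradedProj K n 𝓜)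
    {N : Submodule (Poly K n) M} (hN : G.IsHomog N) :
    ∃ (T : MinSubmodule K n) (φ : (Fin T.rank → Poly K n) →ₗ[Poly K n] M),
      (∀ j, ∀ v ∈ shiftedPi T.shift (polyGrading K n) j, φ v ∈ 𝓜 j) ∧
      LinearMap.range φ = N ∧ LinearMap.ker φ = T.sub := by
  obtain ⟨r, a, g, hg, hr, hmin⟩ := G.exists_minimal_generators hN
  refine ⟨⟨r, a, LinearMap.ker (Fintype.linearCombination (Poly K n) g), ?_, fun v hv => hmin v hv⟩,
    Fintype.linearCombination (Poly K n) g, fun j v hv => G.linearCombination_mem hg hv, hr, rfl⟩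
  intro v hv j
  rw [LinearMap.mem_ker] at hv ⊢
  rw [← G.proj_linearCombination hg, hv, map_zero]

/-- The next step of a minimal resolution. -/
theorem MinSubmodule.exists_next (T : MinSubmodule K n) :
    ∃ (T' : MinSubmodule K n)
      (φ : (Fin T'.rank → Poly K n) →ₗ[Poly K n] (Fin T.rank → Poly K n)),
      (∀ j, ∀ v ∈ shiftedPi T'.shift (polyGrading K n) j,
        φ v ∈ shiftedPi T.shift (polyGrading K n) j) ∧
      LinearMap.range φ = T.sub ∧ LinearMap.ker φ = T'.sub :=
  (freeGradedProj T.shift).exists_minimal_cover T.homog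

/-- A finitely generated graded module has a minimal graded free resolution. -/
theorem GradedProj.exists_minimal_resolution [Module.Finite (Poly K n) M] (G : GradedProj K n 𝓜) :
    ∃ F : GradedFreeResolution K n 𝓜, ∀ i v c, MvPolynomial.constantCoeff (F.d i v c) = 0 := by
  have : IsNoetherian (Poly K n) M := isNoetherian_of_isNoetherianRing_of_finite _ _
  obtain ⟨T0, aug, haug, hr, hk⟩ := G.exists_minimal_cover (N := ⊤) fun _ _ _ => trivial
  choose next φ hφ hφr hφk using MinSubmodule.exists_next (K := K) (n := n)
  let T : ℕ → MinSubmodule K n := fun i => Nat.rec T0 (fun _ T => next T) i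
  refine ⟨⟨fun i => (T i).rank, fun i => (T i).shift, fun i => φ (T i), aug, fun i => hφ (T i),
    haug, fun i => ?_, ?_, LinearMap.range_eq_top.1 hr⟩, fun i v c => ?_⟩
  · rw [LinearMap.exact_iff, hφk, hφr]
  · rw [LinearMap.exact_iff, hk]; exact (hφr T0).symm
  · exact (T i).min _ (by rw [← hφr]; exact ⟨v, rfl⟩) c

/-- The matrices of a graded free resolution. -/
abbrev GradedFreeResolution.toFreeSeq (F : GradedFreeResolution K n 𝓜) : FreeSeq K n where
  rank := F.rank
  shift := F.shift
  mat p := LinearMap.toMatrix' (F.d p)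
  mat_hom p a b := by
    intro β hβ
    have h1 : (Pi.single b 1 : Fin (F.rank (p + 1)) → Poly K n) ∈
        shiftedPi (F.shift (p + 1)) (polyGrading K n) (F.shift (p + 1) b) := by
      intro c _
      change (Pi.single b 1 : _ → Poly K n) c ∈ polyGrading K n (F.shift (p + 1) b - F.shift (p + 1) c)
      by_cases h : c = b
      · subst h
        rw [Pi.single_eq_same, sub_self]
        exact MvPolynomial.isHomogeneous_one _ _
      · rw [Pi.single_eq_of_ne h]; exact zero_mem _
    have h2 : F.d p (Pi.single b 1) a ∈ polyGrading K n (F.shift (p + 1) b - F.shift p a) :=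
      F.d_mem p _ _ h1 a trivial
    rw [mem_polyGrading_iff] at h2
    refine h2 β ?_
    rwa [LinearMap.toMatrix'_apply] at hβ
  mat_mul p := by
    rw [← LinearMap.toMatrix'_comp]
    have : F.d p ∘ₗ F.d (p + 1) = 0 := by
      ext1 v
      exact LinearMap.ext fun w => by
        simpa using (F.exact_d p).apply_apply_eq_zero _
    rw [this, map_zero]

theorem GradedFreeResolution.toFreeSeq_mulVec (F : GradedFreeResolution K n 𝓜) (p : ℕ)
    (v : Fin (F.rank (p + 1)) → Poly K n) : (F.toFreeSeq.mat p).mulVec v = F.d p v := by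
  change (LinearMap.toMatrix' (F.d p)).mulVec v = _
  rw [← Matrix.toLin'_apply, Matrix.toLin'_toMatrix']

theorem GradedFreeResolution.acyclic (F : GradedFreeResolution K n 𝓜) : F.toFreeSeq.Acyclic := by
  intro p v hv
  obtain ⟨u, hu⟩ := (F.exact_d p v).1 ((F.toFreeSeq_mulVec p v).symm.trans hv)
  exact ⟨u, (F.toFreeSeq_mulVec (p + 1) u).trans hu⟩

theorem GradedFreeResolution.exists_mulVec_eq_smul (F : GradedFreeResolution K n 𝓜)
    {a : Poly K n} (ha : a ∈ Module.annihilator (Poly K n) M) (v : Fin (F.rank 0) → Poly K n) :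
    ∃ u, (F.toFreeSeq.mat 0).mulVec u = a • v := by
  obtain ⟨u, hu⟩ := (F.exact_aug (a • v)).1 (by
    rw [map_smul]; exact Module.mem_annihilator.1 ha _)
  exact ⟨u, by rw [F.toFreeSeq_mulVec, hu]⟩

end MinimalResolution

/-! ### Lifting Koszul cycles to the total complex -/

section Staircase

variable {K : Type*} [Field K] {n l : ℕ}

theorem kosD_map {R : Type*} [CommRing R] {l : ℕ} (x : Fin l → R) {V W : Type*} [AddCommGroup V]
    [Module R V] [AddCommGroup W] [Module R W] (φ : V →ₗ[R] W) (z : Finset (Fin l) → V)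
    (s : Finset (Fin l)) : kosD x W (fun s => φ (z s)) s = φ (kosD x V z s) := by
  rw [kosD_apply, kosD_apply, map_sum]
  refine Finset.sum_congr rfl fun i _ => ?_
  split_ifs <;> simp

theorem kosD_sign_smul {R : Type*} [CommRing R] {l : ℕ} (x : Fin l → R) {V : Type*}
    [AddCommGroup V] [Module R V] (z : Finset (Fin l) → V) (s : Finset (Fin l)) :
    kosD x V (fun s => ((-1) ^ s.card : R) • z s) s = -((-1) ^ s.card : R) • kosD x V z s := by
  rw [kosD_apply, kosD_apply, Finset.smul_sum]
  refine Finset.sum_congr rfl fun i _ => ?_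
  split_ifs with h
  · simp
  · rw [Finset.card_insert_of_notMem h, smul_smul, smul_smul]
    congr 1; ring

variable {M N : Type*} [AddCommGroup M] [Module (Poly K n) M] [AddCommGroup N]
  [Module (Poly K n) N] {𝓜 : ℤ → AddSubgroup M} {𝓝 : ℤ → AddSubgroup N}

theorem GradedProj.proj_map (G : GradedProj K n 𝓜) (H : GradedProj K n 𝓝) (φ : M →+ N)
    (hφ : ∀ j, ∀ m ∈ 𝓜 j, φ m ∈ 𝓝 j) (j : ℤ) (m : M) :
    H.proj j (φ m) = φ (G.proj j m) := by
  obtain ⟨s, hs⟩ := G.exists_sum m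
  rw [← hs, map_sum, map_sum, map_sum, map_sum]
  refine Finset.sum_congr rfl fun i _ => ?_
  rw [H.of_mem (hφ i _ (G.mem i m)), G.of_mem (G.mem i m)]
  split_ifs <;> simp

/-- The Koszul differential preserves degrees. -/
theorem GradedProj.kosD_mem (G : GradedProj K n 𝓜) {x : Fin l → Poly K n} {d : Fin l → ℕ}
    (hx : ∀ i, (x i).IsHomogeneous (d i)) {j : ℤ} {z : Finset (Fin l) → M}
    (hz : ∀ s, z s ∈ 𝓜 (j - ∑ i ∈ s, (d i : ℤ))) (s : Finset (Fin l)) :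
    kosD x M z s ∈ 𝓜 (j - ∑ i ∈ s, (d i : ℤ)) := by
  rw [kosD_apply]
  refine sum_mem fun i _ => ?_
  split_ifs with hi
  · exact zero_mem _
  · have h1 := G.smul_mem (d i) _ (x i) _ (hx i) (hz (insert i s))
    rw [Finset.sum_insert hi, show (d i : ℤ) + (j - (d i + ∑ i ∈ s, (d i : ℤ))) =
      j - ∑ i ∈ s, (d i : ℤ) by ring] at h1
    rw [mul_smul, insSign]
    rcases neg_one_pow_eq_or (Poly K n) (s.filter (· < i)).card with h | h
    · rwa [h, one_smul]
    · rw [h, neg_smul, one_smul]; exact neg_mem h1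

variable (F : GradedFreeResolution K n 𝓜)

/-- The conditions on the `p`-th row of the lift of a Koszul cycle of degree `j` to the total
complex of a free resolution. -/
structure GradedFreeResolution.IsLiftRow (x : Fin l → Poly K n) (d : Fin l → ℕ) (k : ℕ) (j : ℤ)
    (p : ℕ) (c : Finset (Fin l) → Fin (F.rank p) → Poly K n) : Prop where
  mem : ∀ s, c s ∈ shiftedPi (F.shift p) (polyGrading K n) (j - ∑ i ∈ s, (d i : ℤ))
  eq_zero : ∀ s, s.card + p ≠ k → c s = 0
  exists_preimage : ∀ s, ∃ u, F.d p u = kosD x _ c s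

/-- The new row solves d c' = ∓ D c. Then d(D c') = D(d c') is up to sign D D c = 0, so by exactness
D c' again has preimages and the staircase continues. Preimages are replaced by their homogeneous
components to keep the degree. -/
theorem GradedFreeResolution.IsLiftRow.exists_next {x : Fin l → Poly K n} {d : Fin l → ℕ}
    (hx : ∀ i, (x i).IsHomogeneous (d i)) {k : ℕ} {j : ℤ} {p : ℕ}
    {c : Finset (Fin l) → Fin (F.rank p) → Poly K n} (hc : F.IsLiftRow x d k j p c) :
    ∃ c', F.IsLiftRow x d k j (p + 1) c' ∧
      ∀ s, kosD x _ c s + ((-1) ^ s.card : Poly K n) • F.d p (c' s) = 0 := by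
  classical
  choose u hu using hc.exists_preimage
  have hlift : ∀ s, F.d p ((freeGradedProj (F.shift (p + 1))).proj (j - ∑ i ∈ s, (d i : ℤ)) (u s)) =
      kosD x _ c s := by
    intro s
    have h1 := (freeGradedProj (F.shift (p + 1))).proj_map (freeGradedProj (F.shift p))
      (F.d p).toAddMonoidHom (F.d_mem p) (j - ∑ i ∈ s, (d i : ℤ)) (u s)
    refine h1.symm.trans ?_
    change (freeGradedProj (F.shift p)).proj _ (F.d p (u s)) = _
    rw [hu, (freeGradedProj (F.shift p)).of_mem
      ((freeGradedProj (F.shift p)).kosD_mem hx hc.mem s), if_pos rfl]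
  have hzero : ∀ s, s.card + (p + 1) ≠ k → kosD x _ c s = 0 := by
    intro s hs
    rw [kosD_apply]
    refine Finset.sum_eq_zero fun i _ => ?_
    split_ifs with hi
    · rfl
    · rw [hc.eq_zero, smul_zero]
      rw [Finset.card_insert_of_notMem hi]; omega
  let c' : Finset (Fin l) → Fin (F.rank (p + 1)) → Poly K n := fun s =>
    if s.card + (p + 1) = k then (-((-1) ^ s.card : Poly K n)) •
      (freeGradedProj (F.shift (p + 1))).proj (j - ∑ i ∈ s, (d i : ℤ)) (u s) else 0
  have hc' : ∀ s, F.d p (c' s) = (-((-1) ^ s.card : Poly K n)) • kosD x _ c s := by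
    intro s
    by_cases h : s.card + (p + 1) = k
    · simp only [c', if_pos h]
      rw [map_smul, hlift]
    · simp only [c', if_neg h]
      rw [map_zero, hzero s h, smul_zero]
  refine ⟨c', ⟨fun s => ?_, fun s hs => if_neg hs, fun s => ?_⟩, fun s => ?_⟩
  · simp only [c']
    split_ifs
    · have h1 := (freeGradedProj (F.shift (p + 1))).mem (j - ∑ i ∈ s, (d i : ℤ)) (u s)
      rcases neg_one_pow_eq_or (Poly K n) s.card with h | h
      · rw [h, neg_smul, one_smul]; exact neg_mem h1
      · rwa [h, neg_neg, one_smul]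
    · exact zero_mem _
  · refine (F.exact_d p _).1 ?_
    rw [← kosD_map, funext hc']
    simp only [neg_smul]
    have h1 := map_neg (kosD x (Fin (F.rank p) → Poly K n))
      (fun s => ((-1) ^ s.card : Poly K n) • kosD x _ c s)
    refine (congrFun h1 s).trans ?_
    rw [Pi.neg_apply, kosD_sign_smul, kosD_kosD, Pi.zero_apply, smul_zero, neg_zero]
  · rw [hc', smul_smul, mul_neg, ← mul_pow, neg_mul_neg, one_mul, one_pow, neg_smul, one_smul,
      add_neg_cancel]

theorem GradedFreeResolution.toFreeSeq_diff (v : F.toFreeSeq.Coeff (Poly K n)) (p : ℕ) :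
    F.toFreeSeq.diff (Poly K n) v p = F.d p (v (p + 1)) := by
  rw [← F.toFreeSeq_mulVec]
  funext a
  rw [FreeSeq.diff_apply, Matrix.mulVec, dotProduct]
  rfl

theorem FreeSeq.kosD_coeff (F : FreeSeq K n) (x : Fin l → Poly K n) {A : Type*} [AddCommGroup A]
    [Module (Poly K n) A] (z : F.Tot l A) (s : Finset (Fin l)) (p : ℕ) :
    kosD x (F.Coeff A) z s p = kosD x (Fin (F.rank p) → A) (fun s => z s p) s :=
  (kosD_map x (LinearMap.proj (R := Poly K n) (φ := fun p => Fin (F.rank p) → A) p) z s).symm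

/-- A Koszul cycle of degree `j` lifts to a cycle of the total complex of a free resolution. -/
theorem GradedFreeResolution.exists_lift (G : GradedProj K n 𝓜) {x : Fin l → Poly K n}
    {d : Fin l → ℕ} (hx : ∀ i, (x i).IsHomogeneous (d i)) {k : ℕ} {j : ℤ}
    {z : Finset (Fin l) → M} (hz : ∀ s, z s ∈ 𝓜 (j - ∑ i ∈ s, (d i : ℤ)))
    (hz0 : ∀ s, s.card ≠ k → z s = 0) (hDz : kosD x M z = 0) :
    ∃ Z : F.toFreeSeq.Tot l (Poly K n), F.toFreeSeq.totD x _ Z = 0 ∧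
      (∀ s p, Z s p ∈ shiftedPi (F.shift p) (polyGrading K n) (j - ∑ i ∈ s, (d i : ℤ))) ∧
      (∀ s p, s.card + p ≠ k → Z s p = 0) ∧ ∀ s, F.aug (Z s 0) = z s := by
  classical
  choose u hu using fun s => F.aug_surjective (z s)
  let c0 : Finset (Fin l) → Fin (F.rank 0) → Poly K n := fun s =>
    if s.card = k then (freeGradedProj (F.shift 0)).proj (j - ∑ i ∈ s, (d i : ℤ)) (u s) else 0
  have haug : ∀ s, F.aug (c0 s) = z s := by
    intro s
    by_cases h : s.card = k
    · simp only [c0, if_pos h]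
      have h1 := (freeGradedProj (F.shift 0)).proj_map G
        F.aug.toAddMonoidHom F.aug_mem (j - ∑ i ∈ s, (d i : ℤ)) (u s)
      refine h1.symm.trans ?_
      change G.proj _ (F.aug (u s)) = _
      rw [hu, G.of_mem (hz s), if_pos rfl]
    · simp only [c0, if_neg h]
      rw [map_zero, hz0 s h]
  have hc0 : F.IsLiftRow x d k j 0 c0 := by
    refine ⟨fun s => ?_, fun s hs => if_neg hs, fun s => (F.exact_aug _).1 ?_⟩
    · simp only [c0]
      split_ifs
      · exact (freeGradedProj (F.shift 0)).mem _ _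
      · exact zero_mem _
    · rw [← kosD_map, funext haug, hDz, Pi.zero_apply]
  choose next hnext hD using
    fun p (c : {c // F.IsLiftRow x d k j p c}) => c.2.exists_next F hx
  let c : ∀ p, {c // F.IsLiftRow x d k j p c} := fun p =>
    Nat.rec ⟨c0, hc0⟩ (fun p c => ⟨next p c, hnext p c⟩) p
  refine ⟨fun s p => (c p).1 s, ?_, fun s p => (c p).2.mem s, fun s p => (c p).2.eq_zero s, haug⟩
  funext s p
  rw [FreeSeq.totD_apply, Pi.add_apply, Pi.smul_apply, F.toFreeSeq_diff, FreeSeq.kosD_coeff]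
  exact hD p (c p) s

/-- If the total complex of the polynomial ring with truncated resolution is exact in degree `j`,
then so is the Koszul complex. -/
theorem GradedFreeResolution.exists_kosD_eq (G : GradedProj K n 𝓜) {x : Fin l → Poly K n}
    {d : Fin l → ℕ} (hx : ∀ i, (x i).IsHomogeneous (d i)) {k : ℕ} {j : ℤ}
    (hrel : F.toFreeSeq.RelExact x d (truncIdx l k) (nonnegFrom n 0) (nonnegSome n 0) k j)
    {z : Finset (Fin l) → M} (hz : ∀ s, z s ∈ 𝓜 (j - ∑ i ∈ s, (d i : ℤ)))
    (hz0 : ∀ s, s.card ≠ k → z s = 0) (hDz : kosD x M z = 0) :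
    ∃ b, kosD x M b = z := by
  obtain ⟨Z, hDZ, hZ, hZ0, haug⟩ := F.exists_lift G hx hz hz0 hDz
  have hnat := fun Y => F.toFreeSeq.totD_map x (Algebra.linearMap (Poly K n) (Laurent K n)) Y
  have hsupp : ∀ p : Poly K n, toLaurent K n p ∈ supportedIn K {α | ∃ β ∈ p.support, expEmb n β = α} :=
    fun p => mem_supportedIn.2 fun γ hγ => mem_support_toLaurent hγ
  obtain ⟨b, -, hb, hzb⟩ := hrel (fun s p c => toLaurent K n (Z s p c)) (by
    intro s p c
    by_cases h : s.card + p = k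
    · refine supportedIn_mono ?_ (hsupp _)
      rintro _ ⟨β, hβ, rfl⟩
      refine ⟨show p ≤ k by omega, by exact_mod_cast h, ?_⟩
      have h1 : Z s p c ∈ polyGrading K n (j - ∑ i ∈ s, (d i : ℤ) - F.shift p c) :=
        hZ s p c trivial
      have h2 := mem_polyGrading_iff.1 h1 β hβ
      rw [sum_expEmb, h2, Set.mem_singleton_iff]
      change _ + (_ + F.shift p c) = j
      ring
    · change toLaurent K n (Z s p c) ∈ _
      rw [hZ0 s p h, Pi.zero_apply, map_zero]
      exact zero_mem _)
    (by
      intro s p c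
      refine supportedIn_mono ?_ (hsupp _)
      rintro _ ⟨β, hβ, rfl⟩ r _
      exact expEmb_nonneg β r)
    (by
      have h1 := hnat Z
      rw [hDZ] at h1
      intro s p c
      have h2 := congrFun (congrFun (congrFun h1 s) p) c
      rw [Pi.zero_apply, Pi.zero_apply, Pi.zero_apply, map_zero] at h2
      have h3 : (F.toFreeSeq.totD x (Laurent K n) fun s p c => toLaurent K n (Z s p c)) s p c = 0 :=
        h2
      rw [h3]
      exact zero_mem _)
  have hex : ∀ s p c, ∃ q : Poly K n, toLaurent K n q = b s p c := fun s p c => by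
    obtain ⟨q, hq, -⟩ := exists_toLaurent_eq
      (supportedIn_mono (fun (α : Fin n → ℤ) (hα : α ∈ nonnegFrom n 0) i => hα i (Nat.zero_le _))
        (hb s p c))
    exact ⟨q, hq⟩
  choose B hB using hex
  have hDB : F.toFreeSeq.totD x _ B = Z := by
    funext s p c
    apply toLaurent_injective
    have h1 := congrFun (congrFun (congrFun (hnat B) s) p) c
    have h2 : (fun s p c => Algebra.linearMap (Poly K n) (Laurent K n) (B s p c)) = b := by
      funext s p c; exact hB s p c
    rw [h2] at h1
    refine h1.symm.trans ?_
    have h3 := hzb s p c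
    have h4 : nonnegSome n 0 = ∅ := by
      rw [Set.eq_empty_iff_forall_notMem]
      rintro α ⟨r, hr, -⟩
      omega
    rw [h4] at h3
    exact (sub_eq_zero.1 (eq_zero_of_supportedIn_empty h3)).symm
  -- Augmentation kills the image of F_1, so only the Koszul part of D B in row 0 survives.
  refine ⟨fun s => F.aug (B s 0), funext fun s => ?_⟩
  rw [kosD_map, ← haug, ← hDB, FreeSeq.totD_apply, Pi.add_apply, Pi.smul_apply, F.toFreeSeq_diff,
    FreeSeq.kosD_coeff, map_add, map_smul, F.exact_aug.apply_apply_eq_zero, smul_zero, add_zero]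

end Staircase

/-! ### Regularity of torsion modules -/

section Regularity

variable {K : Type*} [Field K] {n : ℕ}

theorem subquotGrading_eq_bot_iff {C : Type*} [AddCommGroup C] [Module (Poly K n) C]
    {Z B : Submodule (Poly K n) C} {𝓒 : ℤ → AddSubgroup C} {j : ℤ} :
    subquotGrading Z B 𝓒 j = ⊥ ↔ ∀ z ∈ Z, z ∈ 𝓒 j → z ∈ B := by
  rw [subquotGrading, AddSubgroup.map_eq_bot_iff]
  constructor
  · intro h z hz hzj
    have h1 : (⟨z, hz⟩ : Z) ∈ (B.submoduleOf Z).mkQ.toAddMonoidHom.ker := h hzj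
    have h2 : (⟨z, hz⟩ : Z) ∈ B.submoduleOf Z := (Submodule.Quotient.mk_eq_zero _).1 h1
    exact h2
  · rintro h ⟨z, hz⟩ hzj
    exact (Submodule.Quotient.mk_eq_zero _).2 (h z hz hzj)

variable {N : Type*} [AddCommGroup N] [Module (Poly K n) N] {𝓝 : ℤ → AddSubgroup N}

/-- Localizing at a nonempty set of variables kills a torsion module. -/
theorem subsingleton_locAt (hN : ∀ (i : Fin n) (m : N), ∃ r : ℕ,
    (MvPolynomial.X i ^ r : Poly K n) • m = 0) {s : Finset (Fin n)} (hs : s.Nonempty) :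
    Subsingleton (LocAt K N s) := by
  obtain ⟨i, hi⟩ := hs
  refine subsingleton_of_forall_eq 0 fun z => ?_
  induction z using LocalizedModule.induction_on with
  | h m y =>
    obtain ⟨r, hr⟩ := hN i m
    rw [← LocalizedModule.zero_mk y, LocalizedModule.mk_eq]
    refine ⟨⟨varProd K s ^ r, pow_mem (Submonoid.mem_powers _) r⟩, ?_⟩
    rw [smul_zero, smul_zero]
    change varProd K s ^ r • y • m = 0
    rw [smul_comm]
    have h1 : varProd K s ^ r • m = 0 := by
      rw [varProd, ← Finset.mul_prod_erase s _ hi, mul_pow, mul_comm, mul_smul, hr, smul_zero]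
    rw [h1, smul_zero]

theorem subsingleton_cechTerm (hN : ∀ (i : Fin n) (m : N), ∃ r : ℕ,
    (MvPolynomial.X i ^ r : Poly K n) • m = 0) (p : ℕ) :
    Subsingleton (CechTerm K n N (p + 1)) := by
  have : ∀ s : {s : Finset (Fin n) // s.card = p + 1}, Subsingleton (LocAt K N s.1) := fun s =>
    subsingleton_locAt hN (Finset.card_pos.1 (by rw [s.2]; exact Nat.succ_pos p))
  infer_instance

/-- The regularity of a torsion module is at most the largest degree of a nonzero element. -/
theorem reg_le_of_torsion (hN : ∀ (i : Fin n) (m : N), ∃ r : ℕ,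
    (MvPolynomial.X i ^ r : Poly K n) • m = 0) {e : EReal}
    (h : ∀ j, 𝓝 j ≠ ⊥ → ((j : ℝ) : EReal) ≤ e) : reg K n 𝓝 ≤ e := by
  refine sSup_le ?_
  rintro _ ⟨i, j, hij, rfl⟩
  obtain _ | i := i
  · rw [Nat.cast_zero, zero_add]
    refine h j fun hj => hij ?_
    rw [localCohomologyGrading, subquotGrading_eq_bot_iff]
    intro z _ hz
    have hz0 : z = 0 := by
      funext s
      have h1 : locGrading K 𝓝 s.1 j = ⊥ := by
        rw [locGrading, AddSubgroup.closure_eq_bot_iff]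
        rintro _ ⟨r, m, hm, rfl⟩
        rw [s.2, Nat.cast_zero, mul_zero, add_zero, hj, AddSubgroup.mem_bot] at hm
        rw [hm, LocalizedModule.zero_mk]
        rfl
      have h2 : z s ∈ locGrading K 𝓝 s.1 j := hz s trivial
      rw [h1] at h2
      exact h2
    rw [hz0]
    exact zero_mem _
  · refine absurd ?_ hij
    rw [localCohomologyGrading, subquotGrading_eq_bot_iff]
    intro z _ _
    have := subsingleton_cechTerm hN i
    rw [Subsingleton.elim z 0]
    exact zero_mem _

/-- The regularity of a torsion module is at least the degree of each nonzero element. -/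
theorem le_reg_of_torsion (hN : ∀ (i : Fin n) (m : N), ∃ r : ℕ,
    (MvPolynomial.X i ^ r : Poly K n) • m = 0) {j : ℤ} (h : 𝓝 j ≠ ⊥) :
    ((j : ℝ) : EReal) ≤ reg K n 𝓝 := by
  refine le_sSup ⟨0, j, fun hj => h ?_, by simp⟩
  rw [localCohomologyGrading, subquotGrading_eq_bot_iff] at hj
  rw [AddSubgroup.eq_bot_iff_forall]
  intro m hm
  have h1 := hj (fun s => LocalizedModule.mk m 1) (by
      have := subsingleton_cechTerm hN 0
      exact LinearMap.mem_ker.2 (Subsingleton.elim _ _))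
    (fun s _ => AddSubgroup.subset_closure ⟨0, m, by simpa using hm, by
      congr 1⟩)
  have h2 : (LocalizedModule.mk m 1 : LocAt K N (∅ : Finset (Fin n))) = 0 :=
    congrFun h1 ⟨∅, Finset.card_empty⟩
  rw [← LocalizedModule.zero_mk 1, LocalizedModule.mk_eq] at h2
  obtain ⟨⟨_, r, rfl⟩, hu⟩ := h2
  rw [one_smul, smul_zero, smul_zero] at hu
  have h3 : (varProd K (∅ : Finset (Fin n)) ^ r) • m = 0 := hu
  simpa [varProd] using h3

end Regularity

/-! ### Tor computed from a minimal resolution -/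

section MinimalTor

variable {K : Type*} [Field K] {n : ℕ} {M : Type*} [AddCommGroup M] [Module (Poly K n) M]
  {𝓜 : ℤ → AddSubgroup M} (F : GradedFreeResolution K n 𝓜)

theorem smul_residueField {a : Poly K n} (ha : MvPolynomial.constantCoeff a = 0)
    (r : ResidueField K n) : a • r = 0 := by
  obtain ⟨b, rfl⟩ := Ideal.Quotient.mk_surjective r
  rw [← Ideal.Quotient.mk_eq_mk, ← Submodule.Quotient.mk_smul, Submodule.Quotient.mk_eq_zero,
    smul_eq_mul]
  exact Ideal.mul_mem_right b _ (mem_irrIdeal.2 ha)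

theorem tmul_residueField_eq_zero {r : ℕ} {v : Fin r → Poly K n}
    (hv : ∀ c, MvPolynomial.constantCoeff (v c) = 0) (a : ResidueField K n) :
    v ⊗ₜ[Poly K n] a = 0 := by
  rw [pi_eq_sum_univ' v, TensorProduct.sum_tmul]
  refine Finset.sum_eq_zero fun c _ => ?_
  rw [TensorProduct.smul_tmul, smul_residueField (hv c), TensorProduct.tmul_zero]

theorem single_tmul_one_ne_zero {r : ℕ} (c : Fin r) :
    (Pi.single c 1 : Fin r → Poly K n) ⊗ₜ[Poly K n] (1 : ResidueField K n) ≠ 0 := by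
  intro h
  have h1 := congrArg (TensorProduct.lid (Poly K n) (ResidueField K n) ∘
    LinearMap.rTensor (ResidueField K n)
      (LinearMap.proj c : (Fin r → Poly K n) →ₗ[Poly K n] Poly K n)) h
  simp only [Function.comp_apply, LinearMap.rTensor_tmul, LinearMap.proj_apply, Pi.single_eq_same,
    TensorProduct.lid_tmul, one_smul, map_zero] at h1
  have h2 : (1 : Poly K n) ∈ irrIdeal K n := Ideal.Quotient.eq_zero_iff_mem.1 h1
  exact irrIdeal_isPrime.ne_top ((Ideal.eq_top_iff_one _).2 h2)

theorem GradedFreeResolution.tensorD_eq_zero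
    (hF : ∀ i v c, MvPolynomial.constantCoeff (F.d i v c) = 0) (i : ℕ) : F.tensorD i = 0 :=
  TensorProduct.ext' fun v a => tmul_residueField_eq_zero (hF i v) a

/-- The shifts of a minimal resolution are bounded by the regularity of `Tor`. -/
theorem GradedFreeResolution.shift_le_t
    (hF : ∀ i v c, MvPolynomial.constantCoeff (F.d i v c) = 0) (k : ℕ) (c : Fin (F.rank k)) :
    ((F.shift k c : ℝ) : EReal) ≤ t K n 𝓜 k := by
  refine le_trans ?_ (le_iSup (fun F : GradedFreeResolution K n 𝓜 => reg K n (F.torGrading k)) F)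
  refine le_reg_of_torsion (fun i m => ⟨1, ?_⟩) fun h => ?_
  · obtain ⟨⟨z, hz⟩, rfl⟩ := Submodule.Quotient.mk_surjective _ m
    rw [pow_one, ← Submodule.Quotient.mk_smul]
    have h1 : (MvPolynomial.X i : Poly K n) • z = 0 := by
      clear hz
      induction z using TensorProduct.induction_on with
      | zero => exact smul_zero _
      | tmul v a =>
        rw [← TensorProduct.tmul_smul, smul_residueField (by simp), TensorProduct.tmul_zero]
      | add z w hz hw => rw [smul_add, hz, hw, add_zero]
    have h2 : (MvPolynomial.X i : Poly K n) • (⟨z, hz⟩ : F.cycles k) = 0 := Subtype.ext h1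
    rw [h2]; rfl
  · rw [GradedFreeResolution.torGrading, subquotGrading_eq_bot_iff] at h
    -- The basis element e_c ⊗ 1 is a cycle, and it is not a boundary because all differentials of F
    -- ⊗ K vanish; its degree is the shift.
    have h1 := h ((Pi.single c 1 : Fin (F.rank k) → Poly K n) ⊗ₜ[Poly K n] 1) (by
        cases k with
        | zero => trivial
        | succ k =>
          change F.tensorD k _ = 0
          rw [F.tensorD_eq_zero hF]; rfl)
      ⟨Pi.single c 1, fun b _ => by
        change (Pi.single c 1 : _ → Poly K n) b ∈ polyGrading K n (F.shift k c - F.shift k b)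
        by_cases hb : b = c
        · subst hb
          rw [Pi.single_eq_same, sub_self]
          exact MvPolynomial.isHomogeneous_one _ _
        · rw [Pi.single_eq_of_ne hb]; exact zero_mem _, rfl⟩
    rw [F.tensorD_eq_zero hF, LinearMap.range_zero, Submodule.mem_bot] at h1
    exact single_tmul_one_ne_zero c h1

end MinimalTor

/-- The m-th element of s in increasing order, counted from 0, is at least m, and d is antitone. -/
theorem sum_le_sum_initial {l n : ℕ} {d : Fin l → ℕ} (hd : Antitone d) {s : Finset (Fin l)}
    (hs : s.card = n) : ∑ i ∈ s, d i ≤ ∑ i : Fin l with i.val < n, d i := by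
  have hnl : n ≤ l := by rw [← hs]; simpa using s.card_le_univ
  let e := s.orderEmbOfFin hs
  have he : ∀ m (h : m < n), m ≤ (e ⟨m, h⟩).val := by
    intro m
    induction m with
    | zero => intro _; exact Nat.zero_le _
    | succ m ih =>
      intro h
      have h1 : e ⟨m, by omega⟩ < e ⟨m + 1, h⟩ := e.strictMono (by simp)
      have h2 := ih (by omega)
      have h3 : (e ⟨m, by omega⟩).val < (e ⟨m + 1, h⟩).val := h1
      omega
  have h1 : ∑ i ∈ s, d i = ∑ i : Fin n, d (e i) := by
    rw [← Finset.sum_coe_sort]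
    exact (Equiv.sum_comp (s.orderIsoOfFin hs).toEquiv fun i : s => d i).symm
  have h2 : ∑ i : Fin l with i.val < n, d i = ∑ i : Fin n, d (Fin.castLE hnl i) := by
    symm
    refine Finset.sum_bij (fun i _ => Fin.castLE hnl i) (by simp) ?_ ?_ (fun _ _ => rfl)
    · intro a _ b _ h
      exact Fin.castLE_injective hnl h
    · intro b hb
      exact ⟨⟨b.val, (Finset.mem_filter.1 hb).2⟩, Finset.mem_univ _, rfl⟩
  rw [h1, h2]
  exact Finset.sum_le_sum fun i _ => hd (he i.val i.2)

/-! ### Vanishing of Koszul homology in large degrees -/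

section KoszulHomology

variable {K : Type*} [Field K] {n l : ℕ} {M : Type*} [AddCommGroup M] [Module (Poly K n) M]
  {𝓜 : ℤ → AddSubgroup M}

theorem exists_X_pow_smul_koszulHomology {x : Fin l → Poly K n}
    (hX : ∀ i : Fin n, ∃ N, MvPolynomial.X i ^ N ∈ Ideal.span (Set.range x)) (k : ℕ) (i : Fin n)
    (m : KoszulHomology x M k) : ∃ r : ℕ, (MvPolynomial.X i ^ r : Poly K n) • m = 0 := by
  obtain ⟨N, hN⟩ := hX i
  obtain ⟨⟨z, hz⟩, rfl⟩ := Submodule.Quotient.mk_surjective _ m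
  refine ⟨N, ?_⟩
  rw [← Submodule.Quotient.mk_smul, Submodule.Quotient.mk_eq_zero]
  exact smul_mem_koszulBoundaries x hz hN

/-- The vanishing of Koszul homology in large degrees. -/
theorem GradedFreeResolution.koszulHomologyGrading_eq_bot (F : GradedFreeResolution K n 𝓜)
    (G : GradedProj K n 𝓜) {x : Fin l → Poly K n} {d : Fin l → ℕ}
    (hx : ∀ i, (x i).IsHomogeneous (d i))
    (hX : ∀ i : Fin n, ∃ N, MvPolynomial.X i ^ N ∈ Ideal.span (Set.range x)) {k : ℕ}
    (hkn : k ≤ n) (hk : (k : ℕ∞) ≤ codim K n M) {j : ℤ}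
    (hj : ∀ s : Finset (Fin l), s.card = n → ∀ c,
      ∑ i ∈ s, (d i : ℤ) + F.shift k c < j + n) :
    koszulHomologyGrading x d 𝓜 k j = ⊥ := by
  obtain ⟨y, dy, hy, hdy, hm⟩ :=
    exists_parameters G.homogIdeal_annihilator (Nat.add_sub_cancel' hkn) hk
  have hrow : ∀ p < k, ∀ j, F.toFreeSeq.RowExact p j := fun p hp j =>
    FreeSeq.rowExact_of_parameters F.acyclic
      (fun a ha v => F.exists_mulVec_eq_smul ha v) hy hdy hm (by omega) j
  have hnull : Ideal.span (Set.range x) ≤ F.toFreeSeq.nullIdeal x (truncIdx l k) := by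
    rw [Ideal.span_le]
    rintro _ ⟨i, rfl⟩
    exact FreeSeq.mem_nullIdeal_of_wedge i fun s p _ h => h
  have htop := FreeSeq.relExact_top_of_degree hx hrow hj
  rw [← nonnegFrom_self] at htop
  have hrel := FreeSeq.relExact_poly_of_top hx (lowerIdx_truncIdx l k)
    (fun i => (hX i).imp fun N hN => hnull hN) htop
  rw [koszulHomologyGrading, subquotGrading_eq_bot_iff]
  intro z hz hzj
  obtain ⟨b, hb⟩ := F.exists_kosD_eq G hx hrel (z := kosExtend z) (fun s => by
      rw [kosExtend]
      split_ifs with h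
      · exact hzj ⟨s, h⟩ trivial
      · exact zero_mem _)
    (fun s hs => dif_neg hs) (kosD_kosExtend_of_mem_cycles x hz)
  exact mem_koszulBoundaries_of_eq x b (by rw [hb, kosRestrict_kosExtend])

end KoszulHomology

end KoszulReg

end

/-! ### The regularity bound -/

theorem theorem1p4 {K : Type*} [Field K] (n : ℕ)
    {M : Type*} [AddCommGroup M] [Module (MvPolynomial (Fin n) K) M]
    [Module.Finite (MvPolynomial (Fin n) K) M]
    (𝓜 : ℤ → AddSubgroup M) (h𝓜 : KoszulReg.IsGradedModule K n 𝓜)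
    (I : Ideal (MvPolynomial (Fin n) K))
    (hI : ringKrullDim (MvPolynomial (Fin n) K ⧸ I) = 0)
    (l : ℕ) (x : Fin l → MvPolynomial (Fin n) K) (d : Fin l → ℕ)
    (hx : ∀ i, (x i).IsHomogeneous (d i)) (hd : Antitone d)
    (hspan : Ideal.span (Set.range x) = I)
    (k : ℕ) (hk : (k : ℕ∞) ≤ KoszulReg.codim K n M) :
    KoszulReg.reg K n (KoszulReg.koszulHomologyGrading x d 𝓜 k) ≤
      ((∑ i : Fin l with i.val < n, d i : ℕ) : EReal) + KoszulReg.t K n 𝓜 k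
        - (n : EReal) := by
  open KoszulReg in
  subst hspan
  have hhom : HomogIdeal (Ideal.span (Set.range x)) :=
    HomogIdeal.span (by rintro _ ⟨i, rfl⟩; exact ⟨d i, hx i⟩)
  have hX := exists_X_pow_mem_of_ringKrullDim hhom hI
  obtain ⟨F, hF⟩ := h𝓜.gradedProj.exists_minimal_resolution
  refine reg_le_of_torsion (exists_X_pow_smul_koszulHomology hX k) fun j hj => ?_
  by_contra hlt
  refine hj ?_
  -- For M = 0 the codimension is infinite and k may exceed n, so this case is separate; otherwise
  -- the height of the annihilator is at most n, giving k ≤ n.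
  by_cases htop : Module.annihilator (Poly K n) M = ⊤
  · have : Subsingleton M := Module.annihilator_eq_top_iff.1 htop
    rw [koszulHomologyGrading, subquotGrading_eq_bot_iff]
    intro z _ _
    rw [Subsingleton.elim z 0]
    exact zero_mem _
  · refine F.koszulHomologyGrading_eq_bot h𝓜.gradedProj hx hX
      (by exact_mod_cast hk.trans (height_le_of_ne_top htop)) hk fun s hs c => ?_
    by_contra hc
    refine hlt ?_
    have h1 : (∑ i ∈ s, (d i : ℤ)) ≤ ((∑ i : Fin l with i.val < n, d i : ℕ) : ℤ) := by
      exact_mod_cast sum_le_sum_initial hd hs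
    have h2 : (j : ℝ) ≤ ((∑ i : Fin l with i.val < n, d i : ℕ) : ℝ) + F.shift k c - n := by
      have h3 : j ≤ ((∑ i : Fin l with i.val < n, d i : ℕ) : ℤ) + F.shift k c - n := by omega
      exact_mod_cast h3
    refine (EReal.coe_le_coe_iff.2 h2).trans ?_
    rw [EReal.coe_sub, EReal.coe_add]
    exact EReal.sub_le_sub (add_le_add le_rfl (F.shift_le_t hF k c)) le_rfl
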